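/- **Null form estimate for radial functions on $\mathbb{R}^{1+2}$.** *Notation.* Write $r=|x|$, $\nabla_{t,x}\phi=(\partial_t\phi,\partial_1\phi,\partial_2\phi)$ (weak derivatives) and $\partial_r=\frac{x}{|x|}\cdot\nabla_x$. All functions are measurable with values in finite-dimensional real normed spaces, and products of values are taken with respect to a fixed bilinear map (for example the product of real or complex scalars, the inner product of vectors, or the product of matrices). With the metric $\mathrm{diag}(-1,+1,+1)$, $$\partial_\alpha\phi\,\partial^\alpha\psi=-\partial_t\phi\,\partial_t\psi+\sum_{j=1}^{2}\partial_j\phi\,\partial_j\psi .$$ Fix $\Lambda$; "Fourier support in $\{|\xi|\sim 2^k\}$" means that for almost every $t$ the function $\phi(t,\cdot)$ is tempered and its Fourier transform is supported in $\{2^k/\Lambda\le|\xi|\le\Lambda 2^k\}$. Fix a smooth non-negative partition of unity $\sum_{\ell\in\mathbb{Z}}\chi_{\{r\sim2^\ell\}}(r)=1$ for $r>0$, with $\chi_{\{r\sim 2^\ell\}}$ supported in $\{c^{-1}2^\ell\le r\le c2^\ell\}$, and smooth cut-offs $0\le\chi_{\{r>2^\ell\}}\le1$ supported in $\{r\ge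 c^{-1}2^\ell\}$ and equal to $1$ on $\{r\ge c2^\ell\}$, where $c\ge1$. Fix $0\le\delta\le\frac1{10}$. Let $\mathcal{A}$ be the set of all pairs $(q,p)$ with $2\le q,p\le\infty$, $\frac1q+\frac1p<\frac12$ and $\frac1q+\frac1p\le\frac12-\delta$, and let $\mathcal{L}=\{\lambda: 0<\lambda<1,\ \delta\le\lambda\le1-\delta\}$. For $\delta=0$ these are the full ranges $\frac1q+\frac1p<\frac12$ and $0<\lambda<1$. *Norms.* For $k\in\mathbb{Z}$ and a radially symmetric function $\psi$ on $\mathbb{R}^{1+2}$ let $$\|\psi\|_{Y_k}=\sup_{\lambda\in\mathcal{L}}2^{-(\frac12+\lambda)k}\|\chi_{\{r>2^{-k}\}}r^{-\lambda}\psi\|_{L^2_tL^\infty_x}+\sup_{\ell\in\mathbb{Z}}\|\chi_{\{r\sim2^\ell\}}r^{-\frac12}\psi\|_{L^2_tL^2_x},$$ $$\|\psi\|_{X_k}=\sup_{(q,p)\in\mathcal{A}}\ \sup_{\lambda\in\mathcal{L}}2^{(\frac1q+\frac2p-1)k}2^{\lambda k}\sum_{\ell\in\mathbb{Z}}\|\chi_{\{r\sim2^\ell\}}r^{\lambda}\psi\|_{L^q_tL^p_x},$$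 $$\|\psi\|_{N_k^\pm}=\sup_{0<\lambda\le\frac12}2^{-(\frac12-\lambda)k}\|r^\lambda\psi\|_{L^2_{t\pm r}L^\infty_{t\mp r}},$$ where in the last line $\psi$ is viewed as a function of the null coordinates $t+r>t-r$ with Lebesgue measure. Define $$\|\psi\|_{Z_k^+}=\inf\bigl\{\|\psi^{(+)}\|_{N_k^+}+\|\psi^{(+)}\|_{Y_k}+\|\psi^{(-)}\|_{X_k}+\|\psi^{(-)}\|_{Y_k}\bigr\},$$ $$\|\psi\|_{Z_k^-}=\inf\bigl\{\|\psi^{(+)}\|_{X_k}+\|\psi^{(+)}\|_{Y_k}+\|\psi^{(-)}\|_{N_k^-}+\|\psi^{(-)}\|_{Y_k}\bigr\},$$ where the infima run over all decompositions $\psi=\psi^{(+)}+\psi^{(-)}$ into radially symmetric functions. For a radially symmetric $\phi$ with Fourier support in $\{|\xi|\sim2^k\}$ let $$\begin{aligned}\|\phi\|_{S_k}=\ &\|\nabla_{t,x}\phi\|_{L^\infty_tL^2_x}+\sup_{(q,p)\in\mathcal{A}}2^{(\frac1q+\frac2p-1)k}\|\nabla_{t,x}\phi\|_{L^q_tL^p_x}+\sup_{\lambda\in\mathcal{L}}2^{(\frac12-\lambda)k}\|\chi_{\{r>2^{-k}\}}r^{-\lambda}\phi\|_{L^2_tL^\infty_x}\\&+\sup_{\ell\in\mathbb{Z}}\|\chi_{\{r\sim2^\ell\}}r^{-\frac12}\nabla_{t,x}\phi\|_{L^2_tL^2_x}+\|(\partial_t+\partial_r)\phi\|_{Z_k^+}+\|(\partial_t-\partial_r)\phi\|_{Z_k^-}.\end{aligned}$$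 **Proposition.** There is a constant $C$, depending only on the fixed data above (value spaces, bilinear product, cut-offs, $\Lambda$, $\delta$), such that for all $\frac32\le p\le\infty$, all $k_1,k_2\in\mathbb{Z}$ and all radially symmetric locally integrable functions $\phi^{(1)},\phi^{(2)}$ on $\mathbb{R}^{1+2}$ with locally integrable weak gradients $\nabla_{t,x}\phi^{(i)}$ and with Fourier support of $\phi^{(i)}$ in $\{|\xi|\sim2^{k_i}\}$, $$\bigl\|\partial_\alpha\phi^{(1)}\,\partial^\alpha\phi^{(2)}\bigr\|_{L^p_{t,x}(\mathbb{R}^{1+2})}\le C\,2^{(1-\frac3{2p})(k_1+k_2)}\,\|\phi^{(1)}\|_{S_{k_1}}\|\phi^{(2)}\|_{S_{k_2}}$$ (with the convention $0\cdot\infty=0$ on the right-hand side). In particular, for $p=\frac32$ the null form is bounded in $L^{3/2}_{t,x}$ by $C\|\phi^{(1)}\|_{S_{k_1}}\|\phi^{(2)}\|_{S_{k_2}}$. -/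

import Mathlib

open MeasureTheory Set
open scoped ENNReal ContDiff FourierTransform SchwartzMap

/-- The plane `ℝ²` with its Euclidean norm. -/
abbrev Plane : Type := EuclideanSpace ℝ (Fin 2)

/-- Space-time `ℝ^{1+2}`, points `(t, x)`. -/
abbrev SpaceTime : Type := ℝ × Plane

noncomputable section

namespace RadialNullForm

/-- The coordinate directions of space-time: index `0` is time, `1` and `2` are space. -/
def coordDir : Fin 3 → SpaceTime :=
  Fin.cons ((1 : ℝ), (0 : Plane)) (fun j : Fin 2 => ((0 : ℝ), EuclideanSpace.single j (1 : ℝ)))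

/-- A radially symmetric function on space-time: for fixed `t` it depends on `|x|` only. -/
def IsRadial {E : Type*} (φ : SpaceTime → E) : Prop :=
  ∀ (t : ℝ) (x y : Plane), ‖x‖ = ‖y‖ → φ (t, x) = φ (t, y)

/-- `g = (∂_t φ, ∂_1 φ, ∂_2 φ) = ∇_{t,x} φ` in the sense of distributions on `ℝ^{1+2}`
(such a `g` is unique almost everywhere). -/
structure IsWeakGrad {E : Type*} [NormedAddCommGroup E] [NormedSpace ℝ E]
    (φ : SpaceTime → E) (g : SpaceTime → PiLp 2 (fun _ : Fin 3 => E)) : Prop where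
  locallyIntegrable : LocallyIntegrable φ volume
  locallyIntegrable_grad : LocallyIntegrable g volume
  integral_eq : ∀ η : SpaceTime → ℝ, ContDiff ℝ ∞ η → HasCompactSupport η → ∀ i : Fin 3,
    ∫ z, η z • g z i = -∫ z, fderiv ℝ η z (coordDir i) • φ z

/-- For almost every time `t`, `φ(t, ·)` is a tempered function on `ℝ²` whose Fourier transform is
supported in the annulus `{2^k / Λ ≤ |ξ| ≤ Λ 2^k}`, i.e. `φ(t, ·)` annihilates every Schwartz
function whose Fourier transform is supported off the annulus. As the annulus is symmetric under
`ξ ↦ -ξ`, it is enough to test with real parts of such functions, which also makes sense for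
functions with values in a real vector space. -/
def HasFourierSupport {E : Type*} [NormedAddCommGroup E] [NormedSpace ℝ E]
    (Λ : ℝ) (k : ℤ) (φ : SpaceTime → E) : Prop :=
  ∀ᵐ t : ℝ,
    (∃ N : ℕ, Integrable (fun x : Plane => ((1 + ‖x‖) ^ N)⁻¹ • φ (t, x)) volume) ∧
    ∀ h : 𝓢(Plane, ℂ),
      Disjoint (tsupport (𝓕 (h : Plane → ℂ)))
        {ξ : Plane | (2 : ℝ) ^ k / Λ ≤ ‖ξ‖ ∧ ‖ξ‖ ≤ Λ * (2 : ℝ) ^ k} →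
      ∫ x : Plane, (h x).re • φ (t, x) = 0

/-- A choice of the smooth radial cut-offs: `bump ℓ` is `χ_{r ∼ 2^ℓ}`, a smooth non-negative
partition of unity on `r > 0` adapted to dyadic shells, and `far ℓ` is `χ_{r > 2^ℓ}`; `c` is the
implicit constant in `r ∼ 2^ℓ` and `r ≳ 2^ℓ`. -/
structure RadialCutoffs where
  c : ℝ
  one_le_c : 1 ≤ c
  bump : ℤ → ℝ → ℝ
  bump_smooth : ∀ ℓ, ContDiff ℝ ∞ (bump ℓ)
  bump_nonneg : ∀ ℓ r, 0 ≤ bump ℓ r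
  bump_support : ∀ ℓ r, bump ℓ r ≠ 0 → (2 : ℝ) ^ ℓ / c ≤ r ∧ r ≤ c * (2 : ℝ) ^ ℓ
  bump_sum : ∀ r, 0 < r → HasSum (fun ℓ => bump ℓ r) 1
  far : ℤ → ℝ → ℝ
  far_smooth : ∀ ℓ, ContDiff ℝ ∞ (far ℓ)
  far_nonneg : ∀ ℓ r, 0 ≤ far ℓ r
  far_le_one : ∀ ℓ r, far ℓ r ≤ 1
  far_support : ∀ ℓ r, far ℓ r ≠ 0 → (2 : ℝ) ^ ℓ / c ≤ r
  far_eq_one : ∀ ℓ r, c * (2 : ℝ) ^ ℓ ≤ r → far ℓ r = 1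

section Norms

variable {E : Type*} [NormedAddCommGroup E]

/-- The number `2^a`, as an extended non-negative real. -/
def twoPow (a : ℝ) : ℝ≥0∞ := ENNReal.ofReal ((2 : ℝ) ^ a)

/-- The mixed norm `‖f‖_{L^q_t L^p_x}`. -/
def mixedNorm (q p : ℝ≥0∞) (f : SpaceTime → E) : ℝ≥0∞ :=
  eLpNorm (fun t : ℝ => eLpNorm (fun x : Plane => f (t, x)) p volume) q volume

/-- The admissible pairs: `2 ≤ q, p ≤ ∞` and `1/q + 1/p < 1/2`, at distance at least `δ` from the
endpoint line `1/q + 1/p = 1/2`. For `δ = 0` the last condition is void. -/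
def Admissible (δ : ℝ) (q p : ℝ≥0∞) : Prop :=
  2 ≤ q ∧ 2 ≤ p ∧ q⁻¹ + p⁻¹ < 2⁻¹ ∧ q⁻¹ + p⁻¹ + ENNReal.ofReal δ ≤ 2⁻¹

/-- The weights `0 < λ < 1` with `δ ≤ λ ≤ 1 - δ`; for `δ = 0` these are all `0 < λ < 1`. -/
def weights (δ : ℝ) : Set ℝ := Ioo 0 1 ∩ Icc δ (1 - δ)

/-- The exponent `1/q + 2/p - 1`. -/
def strichartzExp (q p : ℝ≥0∞) : ℝ := (q⁻¹).toReal + 2 * (p⁻¹).toReal - 1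

variable [NormedSpace ℝ E]

/-- `χ(r) r^a f`, where `r = |x|`. -/
def weighted (χ : ℝ → ℝ) (a : ℝ) (f : SpaceTime → E) : SpaceTime → E :=
  fun z => (χ ‖z.2‖ * ‖z.2‖ ^ a) • f z

/-- The point `(t, x)` with `x = (r, 0)`, used to read off the profile of a radial function. -/
def ray (t r : ℝ) : SpaceTime := (t, EuclideanSpace.single 0 r)

/-- `‖r^λ ψ‖_{L^2_{t+r} L^∞_{t-r}}` for radial `ψ`, in the null coordinates `u = t + r`,
`v = t - r`, which range over `v < u` (that is, `r > 0`). -/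
def nullNormPlus (lam : ℝ) (ψ : SpaceTime → E) : ℝ≥0∞ :=
  eLpNorm (fun u : ℝ => eLpNorm
    (fun v : ℝ => ((u - v) / 2) ^ lam • ψ (ray ((u + v) / 2) ((u - v) / 2)))
    ∞ (volume.restrict (Iio u))) 2 volume

/-- `‖r^λ ψ‖_{L^2_{t-r} L^∞_{t+r}}` for radial `ψ`, in the same null coordinates. -/
def nullNormMinus (lam : ℝ) (ψ : SpaceTime → E) : ℝ≥0∞ :=
  eLpNorm (fun v : ℝ => eLpNorm
    (fun u : ℝ => ((u - v) / 2) ^ lam • ψ (ray ((u + v) / 2) ((u - v) / 2)))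
    ∞ (volume.restrict (Ioi v))) 2 volume

/-- The auxiliary norm `‖ψ‖_{Y_k}`. -/
def yNorm (χ : RadialCutoffs) (δ : ℝ) (k : ℤ) (ψ : SpaceTime → E) : ℝ≥0∞ :=
  (⨆ lam ∈ weights δ,
      twoPow (-(1 / 2 + lam) * k) * mixedNorm 2 ∞ (weighted (χ.far (-k)) (-lam) ψ)) +
    ⨆ ℓ : ℤ, mixedNorm 2 2 (weighted (χ.bump ℓ) (-(1 / 2)) ψ)

/-- The component of the `Z_k^±` norms that sums over dyadic shells in `r`. -/
def shellNorm (χ : RadialCutoffs) (δ : ℝ) (k : ℤ) (ψ : SpaceTime → E) : ℝ≥0∞ :=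
  ⨆ (q : ℝ≥0∞) (p : ℝ≥0∞) (_ : Admissible δ q p), ⨆ lam ∈ weights δ,
    twoPow (strichartzExp q p * k) * twoPow (lam * k) *
      ∑' ℓ : ℤ, mixedNorm q p (weighted (χ.bump ℓ) lam ψ)

/-- The decompositions `ψ = ψ⁺ + ψ⁻` (almost everywhere) into measurable radial functions. -/
def IsRadialDecomp (ψ ψp ψm : SpaceTime → E) : Prop :=
  StronglyMeasurable ψp ∧ StronglyMeasurable ψm ∧ IsRadial ψp ∧ IsRadial ψm ∧
    ψ =ᵐ[volume] fun z => ψp z + ψm z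

/-- The atomic norm `‖ψ‖_{Z_k^+}`. -/
def zNormPlus (χ : RadialCutoffs) (δ : ℝ) (k : ℤ) (ψ : SpaceTime → E) : ℝ≥0∞ :=
  ⨅ (ψp : SpaceTime → E) (ψm : SpaceTime → E) (_ : IsRadialDecomp ψ ψp ψm),
    ((⨆ lam ∈ Ioc (0 : ℝ) (1 / 2), twoPow (-(1 / 2 - lam) * k) * nullNormPlus lam ψp) +
      yNorm χ δ k ψp) + (shellNorm χ δ k ψm + yNorm χ δ k ψm)

/-- The atomic norm `‖ψ‖_{Z_k^-}`. -/
def zNormMinus (χ : RadialCutoffs) (δ : ℝ) (k : ℤ) (ψ : SpaceTime → E) : ℝ≥0∞ :=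
  ⨅ (ψp : SpaceTime → E) (ψm : SpaceTime → E) (_ : IsRadialDecomp ψ ψp ψm),
    (shellNorm χ δ k ψp + yNorm χ δ k ψp) +
      ((⨆ lam ∈ Ioc (0 : ℝ) (1 / 2), twoPow (-(1 / 2 - lam) * k) * nullNormMinus lam ψm) +
        yNorm χ δ k ψm)

/-- `∂_r φ = (x / |x|) · ∇_x φ`, from `g = ∇_{t,x} φ`. -/
def radialDeriv (g : SpaceTime → PiLp 2 (fun _ : Fin 3 => E)) : SpaceTime → E :=
  fun z => ∑ j : Fin 2, (z.2 j / ‖z.2‖) • g z j.succ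

/-- The norm `‖φ‖_{S_k}` of a function `φ` with space-time gradient `g = ∇_{t,x} φ`. For `δ = 0` the
suprema run over the full open ranges of exponents; for `δ > 0` over ranges that stay away from the
endpoints, as is needed for the norm of a free wave to be finite. -/
def sNorm (χ : RadialCutoffs) (δ : ℝ) (k : ℤ) (φ : SpaceTime → E)
    (g : SpaceTime → PiLp 2 (fun _ : Fin 3 => E)) : ℝ≥0∞ :=
  mixedNorm ∞ 2 g +
  (⨆ (q : ℝ≥0∞) (p : ℝ≥0∞) (_ : Admissible δ q p),
    twoPow (strichartzExp q p * k) * mixedNorm q p g) +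
  (⨆ lam ∈ weights δ,
    twoPow ((1 / 2 - lam) * k) * mixedNorm 2 ∞ (weighted (χ.far (-k)) (-lam) φ)) +
  (⨆ ℓ : ℤ, mixedNorm 2 2 (weighted (χ.bump ℓ) (-(1 / 2)) g)) +
  zNormPlus χ δ k (fun z => g z 0 + radialDeriv g z) +
  zNormMinus χ δ k (fun z => g z 0 - radialDeriv g z)

end Norms

/-- The null form `∂_α φ¹ ∂^α φ² = -∂_t φ¹ ∂_t φ² + ∇_x φ¹ · ∇_x φ²`, from the gradients
`g₁ = ∇_{t,x} φ¹` and `g₂ = ∇_{t,x} φ²`; values are multiplied by the bilinear product `B`. -/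
def nullForm {E₁ E₂ G : Type*} [NormedAddCommGroup E₁] [NormedSpace ℝ E₁]
    [NormedAddCommGroup E₂] [NormedSpace ℝ E₂] [NormedAddCommGroup G] [NormedSpace ℝ G]
    (B : E₁ →L[ℝ] E₂ →L[ℝ] G) (g₁ : SpaceTime → PiLp 2 (fun _ : Fin 3 => E₁))
    (g₂ : SpaceTime → PiLp 2 (fun _ : Fin 3 => E₂)) : SpaceTime → G :=
  fun z => -B (g₁ z 0) (g₂ z 0) + ∑ j : Fin 2, B (g₁ z j.succ) (g₂ z j.succ)

end RadialNullForm

end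

noncomputable section

namespace RadialNullForm

/-! The weak spatial gradient of a radial function is parallel to `x`, so with `L = ∂_t + ∂_r` and
`L' = ∂_t - ∂_r` the null form equals `-(1/2) (Lφ¹ L'φ² + L'φ¹ Lφ²)`: only opposite null derivatives
meet (`ae_nullForm_eq`). This rests on `IsRadial.integral_fderiv_rotationField`, since the gradient
is only a distributional one.

For `p = 3/2`, split `Lφ = ψ⁺ + ψ⁻` and `L'φ' = ζ⁺ + ζ⁻` as in the `Z` norms. In `ψ⁺ ζ⁻` both
factors carry null norms. At weight `λ = 1/2` they give `r^{1/2}|ψ⁺| ≤ a(t + r)` and `r^{1/2}|ζ⁻| ≤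
b(t - r)` with `a, b ∈ L²`. With the polar measure `r dr dt` one is left with `∫∫ (ab)^{3/2}
r^{-1/2}`, which is Hardy-Littlewood-Sobolev for `a^{3/2}, b^{3/2} ∈ L^{4/3}`
(`lintegral_null_mul_inv_sqrt_le`). Each of the other three products has a factor in `X`; Hölder on
dyadic shells pairs `r^{1/2}` times it in `L⁶`, summed over shells, with `r^{-1/2}` times the other
factor in `L²`, bounded uniformly over shells (`RadialCutoffs.exists_shell_bound`). No power of
`2^k` appears in either case.

For `p = ∞`, the pair `(∞, ∞)` in the `S` norm gives `|∇φ| ≤ 2^k ‖φ‖_S`. The range between follows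
from `eLpNorm_le_interpolate`. -/

/-! ### Hardy-Littlewood-Sobolev inequality on the line -/

lemma lintegral_inv_sqrt_Ioc {R : ℝ} (hR : 0 < R) :
    ∫⁻ w in Ioc 0 R, (ENNReal.ofReal w)⁻¹ ^ (1 / 2 : ℝ) = ENNReal.ofReal (2 * R ^ (1 / 2 : ℝ)) := by
  have h1 : ∫ w in Ioc 0 R, w ^ (-(1 / 2) : ℝ) = 2 * R ^ (1 / 2 : ℝ) := by
    rw [← intervalIntegral.integral_of_le hR.le, integral_rpow (Or.inl (by norm_num))]
    norm_num
    ring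
  have h2 : IntegrableOn (fun w : ℝ => w ^ (-(1 / 2) : ℝ)) (Ioc 0 R) :=
    (intervalIntegrable_iff_integrableOn_Ioc_of_le hR.le).1
      (intervalIntegral.intervalIntegrable_rpow' (by norm_num))
  rw [← h1, ofReal_integral_eq_lintegral_ofReal h2
    ((ae_restrict_iff' measurableSet_Ioc).2 (.of_forall fun w hw => Real.rpow_nonneg hw.1.le _))]
  refine setLIntegral_congr_fun measurableSet_Ioc fun w hw => ?_
  rw [← ENNReal.ofReal_inv_of_pos hw.1, ENNReal.ofReal_rpow_of_pos (inv_pos.2 hw.1),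
    Real.inv_rpow hw.1.le, Real.rpow_neg hw.1.le]

lemma lintegral_inv_sq_Ioi {R : ℝ} (hR : 0 < R) :
    ∫⁻ w in Ioi R, (ENNReal.ofReal w)⁻¹ ^ (2 : ℝ) = ENNReal.ofReal R⁻¹ := by
  have h1 : ∫ w in Ioi R, w ^ (-2 : ℝ) = R⁻¹ := by
    rw [integral_Ioi_rpow_of_lt (by norm_num) hR]
    norm_num [Real.rpow_neg_one]
  have h2 : IntegrableOn (fun w : ℝ => w ^ (-2 : ℝ)) (Ioi R) :=
    integrableOn_Ioi_rpow_of_lt (by norm_num) hR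
  rw [← h1, ofReal_integral_eq_lintegral_ofReal h2
    ((ae_restrict_iff' measurableSet_Ioi).2
      (.of_forall fun w hw => Real.rpow_nonneg (hR.trans hw).le _))]
  refine setLIntegral_congr_fun measurableSet_Ioi fun w hw => ?_
  have hw : 0 < w := hR.trans hw
  rw [← ENNReal.ofReal_inv_of_pos hw, ENNReal.ofReal_rpow_of_pos (inv_pos.2 hw),
    Real.inv_rpow hw.le, Real.rpow_neg hw.le]

/-- A weighted Young inequality. -/
lemma rpow_mul_sqrt_le (c x h : ℝ≥0∞) (h₀ : h ≠ 0) (h₁ : h ≠ ⊤) :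
    c ^ (3 / 2 : ℝ) * x ^ (1 / 2 : ℝ) ≤
      c ^ (2 : ℝ) * h ^ (1 / 2 : ℝ) + x ^ (2 : ℝ) * h⁻¹ ^ (3 / 2 : ℝ) := by
  rcases le_total x (c * h) with hc | hc
  · refine le_add_right ?_
    calc c ^ (3 / 2 : ℝ) * x ^ (1 / 2 : ℝ) ≤ c ^ (3 / 2 : ℝ) * (c * h) ^ (1 / 2 : ℝ) := by gcongr
      _ = c ^ (2 : ℝ) * h ^ (1 / 2 : ℝ) := by
        rw [ENNReal.mul_rpow_of_nonneg _ _ (by norm_num), ← mul_assoc,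
          ← ENNReal.rpow_add_of_nonneg _ _ (by norm_num) (by norm_num)]
        norm_num
  · refine le_add_left ?_
    have hc' : c ≤ x * h⁻¹ := by
      rw [← div_eq_mul_inv]
      exact (ENNReal.le_div_iff_mul_le (Or.inl h₀) (Or.inl h₁)).2 hc
    calc c ^ (3 / 2 : ℝ) * x ^ (1 / 2 : ℝ) ≤ (x * h⁻¹) ^ (3 / 2 : ℝ) * x ^ (1 / 2 : ℝ) := by gcongr
      _ = x ^ (2 : ℝ) * h⁻¹ ^ (3 / 2 : ℝ) := by
        rw [ENNReal.mul_rpow_of_nonneg _ _ (by norm_num), mul_right_comm,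
          ← ENNReal.rpow_add_of_nonneg _ _ (by norm_num) (by norm_num)]
        norm_num

/-- This is the inner integral of Hardy-Littlewood-Sobolev over the region where the frozen
function, of value `h`, is the larger one. Truncating `c` at `h` makes the integral near `w = 0`
harmless, and the `L²` bound on `c` handles large `w`. The bound `h²` is then integrable in the
frozen variable. -/
lemma lintegral_min_mul_inv_sqrt_le {c : ℝ → ℝ≥0∞} (hcm : Measurable c)
    (hc : ∫⁻ w, c w ^ (2 : ℝ) ≤ 1) (h : ℝ≥0∞) :
    ∫⁻ w in Ioi (0 : ℝ), (h * min (c w) h) ^ (3 / 2 : ℝ) * (ENNReal.ofReal w)⁻¹ ^ (1 / 2 : ℝ) ≤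
      4 * h ^ (2 : ℝ) := by
  rcases eq_or_ne h 0 with rfl | h₀
  · simp
  rcases eq_or_ne h ⊤ with rfl | h₁
  · simp
  set H := h.toReal with hH
  have Hpos : 0 < H := ENNReal.toReal_pos h₀ h₁
  have hhH : h = ENNReal.ofReal H := (ENNReal.ofReal_toReal h₁).symm
  -- The splitting radius `h⁻²` balances the two parts: `h³ R^{1/2}` and `R⁻¹` both become `h²`.
  set R : ℝ := (H ^ 2)⁻¹ with hR
  have Rpos : 0 < R := by positivity
  have hcancel : h * h⁻¹ = 1 := ENNReal.mul_inv_cancel h₀ h₁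
  have hsplit : Ioi (0 : ℝ) = Ioc 0 R ∪ Ioi R := (Ioc_union_Ioi_eq_Ioi Rpos.le).symm
  have near : ∫⁻ w in Ioc 0 R, (h * min (c w) h) ^ (3 / 2 : ℝ) *
      (ENNReal.ofReal w)⁻¹ ^ (1 / 2 : ℝ) ≤ 2 * h ^ (2 : ℝ) := by
    calc _ ≤ ∫⁻ w in Ioc 0 R, (h * h) ^ (3 / 2 : ℝ) * (ENNReal.ofReal w)⁻¹ ^ (1 / 2 : ℝ) := by
          gcongr
          exact min_le_right _ _
      _ = (h * h) ^ (3 / 2 : ℝ) * ENNReal.ofReal (2 * R ^ (1 / 2 : ℝ)) := by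
          rw [lintegral_const_mul _ (by fun_prop), lintegral_inv_sqrt_Ioc Rpos]
      _ = 2 * h ^ (2 : ℝ) := by
          rw [hhH, ← ENNReal.ofReal_mul Hpos.le, ENNReal.ofReal_rpow_of_pos (by positivity),
            ENNReal.ofReal_rpow_of_pos (by positivity), ← ENNReal.ofReal_mul (by positivity),
            ← ENNReal.ofReal_ofNat, ← ENNReal.ofReal_mul (by positivity)]
          congr 1
          rw [hR, ← pow_two, ← Real.rpow_natCast H 2, Real.inv_rpow (by positivity),
            ← Real.rpow_mul Hpos.le, ← Real.rpow_mul Hpos.le]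
          norm_num
          have : H ^ (3 : ℝ) = H ^ 2 * H := by
            rw [show (3 : ℝ) = ((3 : ℕ) : ℝ) by norm_num, Real.rpow_natCast]; ring
          field_simp
  have far : ∫⁻ w in Ioi R, (h * min (c w) h) ^ (3 / 2 : ℝ) *
      (ENNReal.ofReal w)⁻¹ ^ (1 / 2 : ℝ) ≤ 2 * h ^ (2 : ℝ) := by
    calc _ ≤ ∫⁻ w in Ioi R, (c w ^ (2 : ℝ) * h ^ (2 : ℝ) + (ENNReal.ofReal w)⁻¹ ^ (2 : ℝ)) := by
          refine setLIntegral_mono' measurableSet_Ioi fun w hw => ?_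
          have hw : 0 < w := Rpos.trans hw
          calc _ ≤ (h * c w) ^ (3 / 2 : ℝ) * (ENNReal.ofReal w)⁻¹ ^ (1 / 2 : ℝ) := by
                gcongr
                exact min_le_left _ _
            _ = h ^ (3 / 2 : ℝ) * (c w ^ (3 / 2 : ℝ) * (ENNReal.ofReal w)⁻¹ ^ (1 / 2 : ℝ)) := by
                rw [ENNReal.mul_rpow_of_nonneg _ _ (by norm_num), mul_assoc]
            _ ≤ h ^ (3 / 2 : ℝ) * (c w ^ (2 : ℝ) * h ^ (1 / 2 : ℝ) +
                  (ENNReal.ofReal w)⁻¹ ^ (2 : ℝ) * h⁻¹ ^ (3 / 2 : ℝ)) := by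
                gcongr
                exact rpow_mul_sqrt_le _ _ _ h₀ h₁
            _ = _ := by
                have e1 : h ^ (3 / 2 : ℝ) * h ^ (1 / 2 : ℝ) = h ^ (2 : ℝ) := by
                  rw [← ENNReal.rpow_add_of_nonneg _ _ (by norm_num) (by norm_num)]; norm_num
                have e2 : h ^ (3 / 2 : ℝ) * h⁻¹ ^ (3 / 2 : ℝ) = 1 := by
                  rw [← ENNReal.mul_rpow_of_nonneg _ _ (by norm_num), hcancel, ENNReal.one_rpow]
                rw [mul_add, mul_left_comm, e1, mul_left_comm, e2, mul_one]
      _ = (∫⁻ w in Ioi R, c w ^ (2 : ℝ)) * h ^ (2 : ℝ) + ENNReal.ofReal R⁻¹ := by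
          rw [lintegral_add_left (by fun_prop), lintegral_mul_const _ (by fun_prop),
            lintegral_inv_sq_Ioi Rpos]
      _ ≤ 1 * h ^ (2 : ℝ) + h ^ (2 : ℝ) := by
          gcongr
          · exact (setLIntegral_le_lintegral _ _).trans hc
          · rw [hhH, ENNReal.ofReal_rpow_of_pos Hpos, hR, inv_inv]
            norm_num
      _ = 2 * h ^ (2 : ℝ) := by ring
  rw [hsplit, lintegral_union measurableSet_Ioi (Ioc_disjoint_Ioi le_rfl)]
  calc _ ≤ 2 * h ^ (2 : ℝ) + 2 * h ^ (2 : ℝ) := add_le_add near far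
    _ = _ := by ring

lemma lintegral_comp_mul_left {f : ℝ → ℝ≥0∞} (hf : Measurable f) {a : ℝ} (ha : a ≠ 0) :
    ∫⁻ x, f (a * x) = ENNReal.ofReal |a⁻¹| * ∫⁻ x, f x := by
  rw [← lintegral_map hf (measurable_const_mul a), Real.map_volume_mul_left ha,
    lintegral_smul_measure, smul_eq_mul]

/-- The Hardy-Littlewood-Sobolev inequality on the line, for the kernel `|u - v|^{-1/2}`, written in
the coordinates `u = t + r` and `v = t - r`. -/
lemma lintegral_null_mul_inv_sqrt_le {a b : ℝ → ℝ≥0∞} (ham : Measurable a) (hbm : Measurable b)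
    (ha : ∫⁻ u, a u ^ (2 : ℝ) ≤ 1) (hb : ∫⁻ v, b v ^ (2 : ℝ) ≤ 1) :
    ∫⁻ r in Ioi (0 : ℝ), ∫⁻ t, (a (t + r) * b (t - r)) ^ (3 / 2 : ℝ) *
      (ENNReal.ofReal r)⁻¹ ^ (1 / 2 : ℝ) ≤ 8 := by
  -- The signs `s = 1` and `s = -1` treat the regions where `a` and `b` respectively dominate. The
  -- shift `t ↦ t - s r` freezes the argument of the dominant function `f`.
  have key : ∀ (s : ℝ) (f g : ℝ → ℝ≥0∞), |s| = 1 → Measurable f → Measurable g →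
      ∫⁻ u, f u ^ (2 : ℝ) ≤ 1 → ∫⁻ u, g u ^ (2 : ℝ) ≤ 1 →
      ∫⁻ r in Ioi (0 : ℝ), ∫⁻ t, (f (t + s * r) * min (g (t - s * r)) (f (t + s * r))) ^ (3 / 2 : ℝ) *
        (ENNReal.ofReal r)⁻¹ ^ (1 / 2 : ℝ) ≤ 4 := by
    intro s f g hs hfm hgm hf hg
    have hs0 : s ≠ 0 := by rintro rfl; simp at hs
    calc _ = ∫⁻ r in Ioi (0 : ℝ), ∫⁻ t, (f t * min (g (t - 2 * s * r)) (f t)) ^ (3 / 2 : ℝ) *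
          (ENNReal.ofReal r)⁻¹ ^ (1 / 2 : ℝ) := by
          refine lintegral_congr fun r => ?_
          rw [← lintegral_add_right_eq_self _ (-(s * r))]
          refine lintegral_congr fun t => ?_
          rw [show t + -(s * r) + s * r = t by ring, show t + -(s * r) - s * r = t - 2 * s * r by ring]
      _ = ∫⁻ t, ∫⁻ r in Ioi (0 : ℝ), (f t * min (g (t - 2 * s * r)) (f t)) ^ (3 / 2 : ℝ) *
          (ENNReal.ofReal r)⁻¹ ^ (1 / 2 : ℝ) := by
          refine lintegral_lintegral_swap (Measurable.aemeasurable ?_)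
          simp only [Function.uncurry_def]
          fun_prop
      _ ≤ ∫⁻ t, 4 * f t ^ (2 : ℝ) := by
          refine lintegral_mono fun t => lintegral_min_mul_inv_sqrt_le (by fun_prop) ?_ (f t)
          -- Since `t - r` and `t + r` differ by `2r`, the substitution has Jacobian `1/2`, which is
          -- simply bounded by `1`.
          have e := lintegral_comp_mul_left (f := fun x => g (t - x) ^ (2 : ℝ)) (by fun_prop)
            (show 2 * s ≠ 0 by simpa using hs0)
          rw [e, lintegral_sub_left_eq_self (fun x => g x ^ (2 : ℝ)) t, abs_inv, abs_mul, hs]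
          calc _ ≤ ENNReal.ofReal 1 * 1 := by
                gcongr
                norm_num
            _ = 1 := by simp
      _ = 4 * ∫⁻ t, f t ^ (2 : ℝ) := lintegral_const_mul _ (by fun_prop)
      _ ≤ 4 * 1 := by gcongr
      _ = 4 := mul_one 4
  have h1 := key 1 a b (by simp) ham hbm ha hb
  have h2 := key (-1) b a (by simp) hbm ham hb ha
  calc _ ≤ ∫⁻ r in Ioi (0 : ℝ), ((∫⁻ t, (a (t + 1 * r) * min (b (t - 1 * r)) (a (t + 1 * r))) ^
          (3 / 2 : ℝ) * (ENNReal.ofReal r)⁻¹ ^ (1 / 2 : ℝ)) +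
        ∫⁻ t, (b (t + -1 * r) * min (a (t - -1 * r)) (b (t + -1 * r))) ^
          (3 / 2 : ℝ) * (ENNReal.ofReal r)⁻¹ ^ (1 / 2 : ℝ)) := by
        refine lintegral_mono fun r => ?_
        rw [← lintegral_add_left (by fun_prop)]
        refine lintegral_mono fun t => ?_
        simp only [one_mul, neg_mul, sub_neg_eq_add, ← sub_eq_add_neg]
        rcases le_total (a (t + r)) (b (t - r)) with h | h
        · rw [min_eq_left h, mul_comm (a _)]
          exact le_add_self
        · rw [min_eq_left h]
          exact le_self_add
    _ ≤ 4 + 4 := by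
        rw [lintegral_add_left]
        · exact add_le_add h1 h2
        · apply Measurable.lintegral_prod_right
          simp only [Function.uncurry_def]
          fun_prop
    _ = 8 := by norm_num

/-! ### Polar and null coordinates; the interaction of opposite null waves -/

/-- Integration of a radial function on the plane in polar coordinates. -/
lemma lintegral_plane_radial {f : ℝ → ℝ≥0∞} (hf : Measurable f) :
    ∫⁻ x : Plane, f ‖x‖ =
      ENNReal.ofReal (2 * Real.pi) * ∫⁻ r in Ioi (0 : ℝ), ENNReal.ofReal r * f r := by
  let e := Complex.orthonormalBasisOneI.repr
  have he : MeasurePreserving e volume volume := e.measurePreserving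
  rw [← he.lintegral_comp (by fun_prop)]
  simp only [LinearIsometryEquiv.norm_map]
  rw [← Complex.lintegral_comp_polarCoord_symm]
  have h1 : ∀ p ∈ polarCoord.target, ENNReal.ofReal p.1 • f ‖Complex.polarCoord.symm p‖ =
      (ENNReal.ofReal p.1 * f p.1) * 1 := by
    intro p hp
    have : 0 < p.1 := by simpa using hp.1
    rw [Complex.norm_polarCoord_symm, abs_of_pos this, smul_eq_mul, mul_one]
  rw [setLIntegral_congr_fun polarCoord.open_target.measurableSet h1, polarCoord_target,
    Measure.volume_eq_prod, ← Measure.prod_restrict,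
    lintegral_prod_mul (f := fun r => ENNReal.ofReal r * f r) (g := fun _ => 1) (by fun_prop)
      (by fun_prop), mul_comm]
  congr 1
  rw [lintegral_one, Measure.restrict_apply_univ, Real.volume_Ioo]
  congr 1
  ring

lemma eLpNorm_top_le_iff {α E : Type*} [MeasurableSpace α] {μ : Measure α} [NormedAddCommGroup E]
    {f : α → E} {c : ℝ≥0∞} : eLpNorm f ⊤ μ ≤ c ↔ ∀ᵐ x ∂μ, ‖f x‖ₑ ≤ c := by
  rw [eLpNorm_exponent_top]
  exact ⟨fun h => ae_le_eLpNormEssSup.mono fun x hx => hx.trans h,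
    eLpNormEssSup_le_of_ae_enorm_bound⟩

/-- An essential supremum is at most `c` exactly when the section of `{c < ‖F‖}` is null, and the
measure of a section depends measurably on the base point. -/
lemma measurable_eLpNorm_top_section {E : Type*} [NormedAddCommGroup E] {F : ℝ × ℝ → E}
    (hF : StronglyMeasurable F) {s : Set (ℝ × ℝ)} (hs : MeasurableSet s) :
    Measurable fun u => eLpNorm (fun v => F (u, v)) ⊤ (volume.restrict {v | (u, v) ∈ s}) := by
  refine measurable_of_Iic fun c => ?_
  have hset : MeasurableSet {z : ℝ × ℝ | z ∈ s ∧ c < ‖F z‖ₑ} :=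
    hs.inter (measurableSet_lt measurable_const hF.enorm)
  have : (fun u => eLpNorm (fun v => F (u, v)) ⊤ (volume.restrict {v | (u, v) ∈ s})) ⁻¹' Iic c =
      (fun u => volume (Prod.mk u ⁻¹' {z : ℝ × ℝ | z ∈ s ∧ c < ‖F z‖ₑ})) ⁻¹' {0} := by
    ext u
    rw [mem_preimage, mem_Iic, eLpNorm_top_le_iff,
      ae_restrict_iff' (show MeasurableSet {v | (u, v) ∈ s} from measurable_prodMk_left hs), ae_iff]
    simp [preimage]
  rw [this]
  exact measurable_measure_prodMk_left hset (measurableSet_singleton 0)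

/-- The hypotheses hold along almost all of each null line, whereas the integral runs over `t` for
fixed `r`. Exchanging the two almost-everywhere quantifiers and translating in `t` reconciles them.
-/
lemma lintegral_null_mul_le {P Q : ℝ → ℝ → ℝ≥0∞} {a b : ℝ → ℝ≥0∞}
    (hP : Measurable (Function.uncurry P)) (hQ : Measurable (Function.uncurry Q))
    (ham : Measurable a) (hbm : Measurable b)
    (hPa : ∀ u, ∀ᵐ r, 0 < r → ENNReal.ofReal r ^ (1 / 2 : ℝ) * P (u - r) r ≤ a u)
    (hQb : ∀ v, ∀ᵐ r, 0 < r → ENNReal.ofReal r ^ (1 / 2 : ℝ) * Q (v + r) r ≤ b v)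
    (ha : ∫⁻ u, a u ^ (2 : ℝ) ≤ 1) (hb : ∫⁻ v, b v ^ (2 : ℝ) ≤ 1) :
    ∫⁻ r in Ioi (0 : ℝ), ∫⁻ t, ENNReal.ofReal r * (P t r * Q t r) ^ (3 / 2 : ℝ) ≤ 8 := by
  have hPa' : ∀ᵐ r : ℝ, ∀ᵐ t : ℝ, 0 < r → ENNReal.ofReal r ^ (1 / 2 : ℝ) * P t r ≤ a (t + r) := by
    have hm : MeasurableSet {z : ℝ × ℝ |
        0 < z.2 → ENNReal.ofReal z.2 ^ (1 / 2 : ℝ) * P (z.1 - z.2) z.2 ≤ a z.1} := by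
      have : Measurable fun z : ℝ × ℝ => P (z.1 - z.2) z.2 :=
        hP.comp ((measurable_fst.sub measurable_snd).prodMk measurable_snd)
      exact (measurableSet_lt measurable_const measurable_snd).imp
        (measurableSet_le (by fun_prop) (by fun_prop))
    have h1 := (Measure.ae_ae_comm (μ := volume) (ν := volume) hm).1 (.of_forall hPa)
    filter_upwards [h1] with r hr
    filter_upwards [(measurePreserving_add_right volume r).quasiMeasurePreserving.ae hr] with t ht
    simpa using ht
  have hQb' : ∀ᵐ r : ℝ, ∀ᵐ t : ℝ, 0 < r → ENNReal.ofReal r ^ (1 / 2 : ℝ) * Q t r ≤ b (t - r) := by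
    have hm : MeasurableSet {z : ℝ × ℝ |
        0 < z.2 → ENNReal.ofReal z.2 ^ (1 / 2 : ℝ) * Q (z.1 + z.2) z.2 ≤ b z.1} := by
      have : Measurable fun z : ℝ × ℝ => Q (z.1 + z.2) z.2 :=
        hQ.comp ((measurable_fst.add measurable_snd).prodMk measurable_snd)
      exact (measurableSet_lt measurable_const measurable_snd).imp
        (measurableSet_le (by fun_prop) (by fun_prop))
    have h1 := (Measure.ae_ae_comm (μ := volume) (ν := volume) hm).1 (.of_forall hQb)
    filter_upwards [h1] with r hr
    filter_upwards [(measurePreserving_sub_right volume r).quasiMeasurePreserving.ae hr] with t ht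
    simpa using ht
  refine le_trans (lintegral_mono_ae ?_) (lintegral_null_mul_inv_sqrt_le ham hbm ha hb)
  refine (ae_restrict_iff' measurableSet_Ioi).2 ?_
  filter_upwards [hPa', hQb'] with r h1 h2 hr
  have hr : 0 < r := hr
  refine lintegral_mono_ae ?_
  filter_upwards [h1, h2] with t h1 h2
  set x := ENNReal.ofReal r with hx
  have hx0 : x ≠ 0 := by simpa [hx] using hr
  have hx1 : x ≠ ⊤ := ENNReal.ofReal_ne_top
  -- The weights contribute `r^{3/2}`, so the polar Jacobian `r` leaves exactly the kernel
  -- `r^{-1/2}`.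
  have e : x * (P t r * Q t r) ^ (3 / 2 : ℝ) =
      ((x ^ (1 / 2 : ℝ) * P t r) * (x ^ (1 / 2 : ℝ) * Q t r)) ^ (3 / 2 : ℝ) * x⁻¹ ^ (1 / 2 : ℝ) := by
    have e1 : (x ^ (1 / 2 : ℝ) * P t r) * (x ^ (1 / 2 : ℝ) * Q t r) = x * (P t r * Q t r) := by
      rw [mul_mul_mul_comm, ← ENNReal.rpow_add _ _ hx0 hx1]
      norm_num
    rw [e1, ENNReal.mul_rpow_of_nonneg x _ (by norm_num), ENNReal.inv_rpow, ← ENNReal.rpow_neg,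
      mul_right_comm, ← ENNReal.rpow_add _ _ hx0 hx1]
    norm_num
  rw [e]
  gcongr
  · exact h1 hr
  · exact h2 hr

section

variable {E : Type*} [NormedAddCommGroup E] [NormedSpace ℝ E]

lemma measurable_ray_comp {α : Type*} [MeasurableSpace α] {f g : α → ℝ} (hf : Measurable f)
    (hg : Measurable g) : Measurable fun z => ray (f z) (g z) := by
  refine hf.prodMk ?_
  have : Continuous fun r : ℝ => EuclideanSpace.single (0 : Fin 2) r := by
    have h := (LinearMap.toSpanSingleton ℝ Plane
      (EuclideanSpace.single (0 : Fin 2) (1 : ℝ))).continuous_of_finiteDimensional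
    refine h.congr fun r => ?_
    ext i
    fin_cases i <;> simp
  exact this.measurable.comp hg

/-- The supremum in the null coordinate `t - r` that defines `nullNormPlus`. -/
def nullSupPlus (ψ : SpaceTime → E) (u : ℝ) : ℝ≥0∞ :=
  eLpNorm (fun v : ℝ => ((u - v) / 2) ^ (1 / 2 : ℝ) • ψ (ray ((u + v) / 2) ((u - v) / 2)))
    ⊤ (volume.restrict (Iio u))

/-- The supremum in the null coordinate `t + r` that defines `nullNormMinus`. -/
def nullSupMinus (ψ : SpaceTime → E) (v : ℝ) : ℝ≥0∞ :=
  eLpNorm (fun u : ℝ => ((u - v) / 2) ^ (1 / 2 : ℝ) • ψ (ray ((u + v) / 2) ((u - v) / 2)))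
    ⊤ (volume.restrict (Ioi v))

lemma measurable_nullSupPlus {ψ : SpaceTime → E} (hψ : StronglyMeasurable ψ) :
    Measurable (nullSupPlus ψ) := by
  refine measurable_eLpNorm_top_section (s := {z : ℝ × ℝ | z.2 < z.1})
    (F := fun z => ((z.1 - z.2) / 2) ^ (1 / 2 : ℝ) •
      ψ (ray ((z.1 + z.2) / 2) ((z.1 - z.2) / 2))) ?_ (measurableSet_lt (by fun_prop) (by fun_prop))
  refine StronglyMeasurable.smul (Measurable.stronglyMeasurable (by fun_prop)) ?_
  exact hψ.comp_measurable (measurable_ray_comp (by fun_prop) (by fun_prop))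

lemma measurable_nullSupMinus {ψ : SpaceTime → E} (hψ : StronglyMeasurable ψ) :
    Measurable (nullSupMinus ψ) := by
  refine measurable_eLpNorm_top_section (s := {z : ℝ × ℝ | z.1 < z.2})
    (F := fun z => ((z.2 - z.1) / 2) ^ (1 / 2 : ℝ) •
      ψ (ray ((z.2 + z.1) / 2) ((z.2 - z.1) / 2))) ?_ (measurableSet_lt (by fun_prop) (by fun_prop))
  refine StronglyMeasurable.smul (Measurable.stronglyMeasurable (by fun_prop)) ?_
  exact hψ.comp_measurable (measurable_ray_comp (by fun_prop) (by fun_prop))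

lemma ae_comp_affine {p : ℝ → Prop} (h : ∀ᵐ x, p x) (c : ℝ) {s : ℝ} (hs : s ≠ 0) :
    ∀ᵐ x : ℝ, p (c + s * x) := by
  have h1 := (measurePreserving_add_left volume c).quasiMeasurePreserving.ae h
  have h2 : Measure.QuasiMeasurePreserving (fun x : ℝ => s * x) volume volume := by
    refine ⟨measurable_const_mul s, ?_⟩
    rw [Real.map_volume_mul_left hs]
    exact Measure.smul_absolutelyContinuous
  exact h2.ae h1

lemma enorm_rpow_smul {r : ℝ} (hr : 0 < r) (s : ℝ) (x : E) :
    ‖r ^ s • x‖ₑ = ENNReal.ofReal r ^ s * ‖x‖ₑ := by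
  rw [enorm_smul, Real.enorm_of_nonneg (Real.rpow_nonneg hr.le s), ENNReal.ofReal_rpow_of_pos hr]

lemma ae_le_nullSupPlus (ψ : SpaceTime → E) (u : ℝ) :
    ∀ᵐ r : ℝ, 0 < r → ENNReal.ofReal r ^ (1 / 2 : ℝ) * ‖ψ (ray (u - r) r)‖ₑ ≤ nullSupPlus ψ u := by
  have h := eLpNorm_top_le_iff.1 (le_refl (nullSupPlus ψ u))
  rw [ae_restrict_iff' measurableSet_Iio] at h
  -- The outgoing line is parametrized by `v = u - 2r`, so that `t = u - r`.
  filter_upwards [ae_comp_affine h u (show (-2 : ℝ) ≠ 0 by norm_num)] with r hr hr0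
  have := hr (by simp only [mem_Iio]; linarith)
  rwa [show (u - (u + -2 * r)) / 2 = r by ring, show (u + (u + -2 * r)) / 2 = u - r by ring,
    enorm_rpow_smul hr0] at this

lemma ae_le_nullSupMinus (ψ : SpaceTime → E) (v : ℝ) :
    ∀ᵐ r : ℝ, 0 < r →
      ENNReal.ofReal r ^ (1 / 2 : ℝ) * ‖ψ (ray (v + r) r)‖ₑ ≤ nullSupMinus ψ v := by
  have h := eLpNorm_top_le_iff.1 (le_refl (nullSupMinus ψ v))
  rw [ae_restrict_iff' measurableSet_Ioi] at h
  filter_upwards [ae_comp_affine h v (show (2 : ℝ) ≠ 0 by norm_num)] with r hr hr0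
  have := hr (by simp only [mem_Ioi]; linarith)
  rwa [show (v + 2 * r - v) / 2 = r by ring, show (v + 2 * r + v) / 2 = v + r by ring,
    enorm_rpow_smul hr0] at this

lemma IsRadial.eq_ray {F : Type*} {ψ : SpaceTime → F} (h : IsRadial ψ) (t : ℝ) (x : Plane) :
    ψ (t, x) = ψ (ray t ‖x‖) :=
  h t _ _ (by simp)

variable {F : Type*} [NormedAddCommGroup F] [NormedSpace ℝ F]

/-- Normalization: Hardy-Littlewood-Sobolev is proved above only in the unit ball of `L²`, and its
bilinear form is recovered by scaling. -/
lemma lintegral_sq_le_one {f : ℝ → ℝ≥0∞} {S : ℝ≥0∞} (hS₀ : S ≠ 0) (hS : S ≠ ⊤)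
    (hf : eLpNorm f 2 volume ≤ S) : ∫⁻ u, (S⁻¹ * f u) ^ (2 : ℝ) ≤ 1 := by
  have h2 : eLpNorm f 2 volume = (∫⁻ u, f u ^ (2 : ℝ)) ^ (1 / 2 : ℝ) := by
    rw [eLpNorm_eq_lintegral_rpow_enorm_toReal (by norm_num) (by norm_num)]
    simp
  have h3 : ∫⁻ u, f u ^ (2 : ℝ) ≤ S ^ (2 : ℝ) := by
    calc _ = ((∫⁻ u, f u ^ (2 : ℝ)) ^ (1 / 2 : ℝ)) ^ (2 : ℝ) := by
          rw [← ENNReal.rpow_mul]; norm_num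
      _ ≤ _ := by gcongr; rwa [← h2]
  calc _ = ∫⁻ u, (S⁻¹) ^ (2 : ℝ) * f u ^ (2 : ℝ) := by
        simp_rw [ENNReal.mul_rpow_of_nonneg _ _ (show (0 : ℝ) ≤ 2 by norm_num)]
    _ = (S⁻¹) ^ (2 : ℝ) * ∫⁻ u, f u ^ (2 : ℝ) :=
        lintegral_const_mul' _ _ (by simp [hS₀])
    _ ≤ (S⁻¹) ^ (2 : ℝ) * S ^ (2 : ℝ) := by gcongr
    _ = 1 := by
        rw [← ENNReal.mul_rpow_of_nonneg _ _ (by norm_num), ENNReal.inv_mul_cancel hS₀ hS,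
          ENNReal.one_rpow]

/-- The interaction of two waves travelling in opposite directions. -/
lemma lintegral_mul_le_of_nullNorm {ψ : SpaceTime → E} {ζ : SpaceTime → F}
    (hψ : StronglyMeasurable ψ) (hζ : StronglyMeasurable ζ) (hψr : IsRadial ψ) (hζr : IsRadial ζ)
    {S T : ℝ≥0∞} (hS₀ : S ≠ 0) (hS : S ≠ ⊤) (hT₀ : T ≠ 0) (hT : T ≠ ⊤)
    (hψS : nullNormPlus (1 / 2) ψ ≤ S) (hζT : nullNormMinus (1 / 2) ζ ≤ T) :
    ∫⁻ z, (‖ψ z‖ₑ * ‖ζ z‖ₑ) ^ (3 / 2 : ℝ) ≤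
      ENNReal.ofReal (2 * Real.pi) * 8 * (S * T) ^ (3 / 2 : ℝ) := by
  have hψm := hψ.enorm
  have hζm := hζ.enorm
  have hψu : Measurable (Function.uncurry fun t r => ‖ψ (ray t r)‖ₑ) :=
    hψm.comp (measurable_ray_comp measurable_fst measurable_snd)
  have hζu : Measurable (Function.uncurry fun t r => ‖ζ (ray t r)‖ₑ) :=
    hζm.comp (measurable_ray_comp measurable_fst measurable_snd)
  have hray : ∀ t : ℝ, Measurable fun r => ray t r := fun t =>
    measurable_ray_comp measurable_const measurable_id
  have hmain := lintegral_null_mul_le (P := fun t r => S⁻¹ * ‖ψ (ray t r)‖ₑ)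
    (Q := fun t r => T⁻¹ * ‖ζ (ray t r)‖ₑ) (hψu.const_mul _) (hζu.const_mul _)
    ((measurable_nullSupPlus hψ).const_mul S⁻¹) ((measurable_nullSupMinus hζ).const_mul T⁻¹)
    (fun u => (ae_le_nullSupPlus ψ u).mono fun r h hr => by
      rw [mul_left_comm]; gcongr; exact h hr)
    (fun v => (ae_le_nullSupMinus ζ v).mono fun r h hr => by
      rw [mul_left_comm]; gcongr; exact h hr)
    (lintegral_sq_le_one hS₀ hS hψS) (lintegral_sq_le_one hT₀ hT hζT)
  have e1 : ∫⁻ z, (‖ψ z‖ₑ * ‖ζ z‖ₑ) ^ (3 / 2 : ℝ) = ENNReal.ofReal (2 * Real.pi) *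
      ∫⁻ r in Ioi (0 : ℝ), ∫⁻ t, ENNReal.ofReal r *
        (‖ψ (ray t r)‖ₑ * ‖ζ (ray t r)‖ₑ) ^ (3 / 2 : ℝ) := by
    rw [Measure.volume_eq_prod, lintegral_prod _ (by fun_prop), lintegral_lintegral_swap
      (f := fun (r : ℝ) (t : ℝ) => ENNReal.ofReal r *
        (‖ψ (ray t r)‖ₑ * ‖ζ (ray t r)‖ₑ) ^ (3 / 2 : ℝ)),
      ← lintegral_const_mul' _ _ ENNReal.ofReal_ne_top]
    · refine lintegral_congr fun t => ?_
      rw [← lintegral_plane_radial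
        (f := fun r => (‖ψ (ray t r)‖ₑ * ‖ζ (ray t r)‖ₑ) ^ (3 / 2 : ℝ)) (((hψm.comp (hray t)).mul (hζm.comp (hray t))).pow_const (3 / 2 : ℝ))]
      refine lintegral_congr fun x => ?_
      rw [hψr.eq_ray t x, hζr.eq_ray t x]
    · refine Measurable.aemeasurable ?_
      exact (measurable_fst.ennreal_ofReal).mul
        (((hψu.comp measurable_swap).mul (hζu.comp measurable_swap)).pow_const _)
  have e2 : ∀ r t : ℝ, ENNReal.ofReal r * (‖ψ (ray t r)‖ₑ * ‖ζ (ray t r)‖ₑ) ^ (3 / 2 : ℝ) =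
      (S * T) ^ (3 / 2 : ℝ) * (ENNReal.ofReal r *
        ((S⁻¹ * ‖ψ (ray t r)‖ₑ) * (T⁻¹ * ‖ζ (ray t r)‖ₑ)) ^ (3 / 2 : ℝ)) := by
    intro r t
    rw [mul_left_comm, ← ENNReal.mul_rpow_of_nonneg _ _ (by norm_num), mul_mul_mul_comm S,
      ← mul_assoc S, ← mul_assoc T, ENNReal.mul_inv_cancel hS₀ hS,
      ENNReal.mul_inv_cancel hT₀ hT, one_mul, one_mul]
  have hST : (S * T) ^ (3 / 2 : ℝ) ≠ ⊤ :=
    ENNReal.rpow_ne_top_of_nonneg (by norm_num) (ENNReal.mul_ne_top hS hT)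
  rw [e1, mul_assoc]
  gcongr
  simp_rw [e2, lintegral_const_mul' _ _ hST]
  rw [mul_comm]
  gcongr

end

/-! ### Hölder's inequality on dyadic shells -/

/-- Minkowski's inequality for countable sums. -/
lemma eLpNorm_tsum_le {α ι : Type*} [MeasurableSpace α] {μ : Measure α} [Countable ι]
    {h : ι → α → ℝ≥0∞} (hm : ∀ i, AEMeasurable (h i) μ) {p : ℝ≥0∞} (hp : 1 ≤ p) (hp' : p ≠ ⊤) :
    eLpNorm (fun x => ∑' i, h i x) p μ ≤ ∑' i, eLpNorm (h i) p μ := by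
  have hp0 : p ≠ 0 := (zero_lt_one.trans_le hp).ne'
  have hpr : 0 < p.toReal := ENNReal.toReal_pos hp0 hp'
  have hmono : ∀ x, Monotone fun s : Finset ι => (∑ i ∈ s, h i x) ^ p.toReal := fun x s t hst => by
    dsimp only
    gcongr
  -- Monotone convergence along the directed family of finite partial sums reduces to the finite
  -- triangle inequality.
  have e1 : ∫⁻ x, (∑' i, h i x) ^ p.toReal ∂μ =
      ⨆ s : Finset ι, ∫⁻ x, (∑ i ∈ s, h i x) ^ p.toReal ∂μ := by
    rw [← lintegral_iSup_directed]
    · refine lintegral_congr fun x => ?_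
      rw [ENNReal.tsum_eq_iSup_sum]
      exact (ENNReal.orderIsoRpow p.toReal hpr).map_iSup _
    · exact fun s => (Finset.aemeasurable_fun_sum s fun i _ => hm i).pow_const _
    · exact Monotone.directed_le fun s t hst x => hmono x hst
  rw [eLpNorm_eq_lintegral_rpow_enorm_toReal hp0 hp']
  simp only [enorm_eq_self]
  rw [e1, one_div, ENNReal.rpow_inv_le_iff hpr]
  refine iSup_le fun s => ?_
  rw [← ENNReal.rpow_inv_le_iff hpr]
  have h2 := eLpNorm_sum_le (μ := μ) (s := s) (f := h)
    (fun i _ => (hm i).aestronglyMeasurable) hp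
  rw [eLpNorm_eq_lintegral_rpow_enorm_toReal hp0 hp'] at h2
  simp only [enorm_eq_self, Finset.sum_apply, one_div] at h2
  exact h2.trans (ENNReal.sum_le_tsum s)

instance holderTriple_two_six : ENNReal.HolderTriple 2 6 (3 / 2) where
  inv_add_inv_eq_inv := by
    rw [← ENNReal.toReal_eq_toReal_iff' (by simp) (by simp),
      ENNReal.toReal_add (by simp) (by simp)]
    simp only [ENNReal.toReal_inv, ENNReal.toReal_div, ENNReal.toReal_ofNat]
    norm_num

section

variable {E F : Type*} [NormedAddCommGroup E] [NormedAddCommGroup F]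

lemma eLpNorm_enorm_mul_enorm_le {α : Type*} [MeasurableSpace α] {μ : Measure α} {f : α → E}
    {g : α → F} (hf : AEStronglyMeasurable f μ) (hg : AEStronglyMeasurable g μ) {p q r : ℝ≥0∞}
    [ENNReal.HolderTriple p q r] :
    eLpNorm (fun z => ‖f z‖ₑ * ‖g z‖ₑ) r μ ≤ eLpNorm f p μ * eLpNorm g q μ := by
  have h := eLpNorm_le_eLpNorm_mul_eLpNorm_of_nnnorm (p := p) (q := q) (r := r) hf hg
    (fun x y => ‖x‖ * ‖y‖) 1 (.of_forall fun x => by simp)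
  rw [ENNReal.coe_one, one_mul] at h
  refine le_trans (eLpNorm_mono_enorm fun z => ?_) h
  simp

lemma mixedNorm_self {f : SpaceTime → E} (hf : StronglyMeasurable f) {p : ℝ≥0∞} (hp₀ : p ≠ 0)
    (hp : p ≠ ⊤) : mixedNorm p p f = eLpNorm f p volume := by
  have hpr : 0 < p.toReal := ENNReal.toReal_pos hp₀ hp
  rw [mixedNorm]
  simp only [eLpNorm_eq_lintegral_rpow_enorm_toReal hp₀ hp, enorm_eq_self]
  rw [Measure.volume_eq_prod, lintegral_prod _ (hf.enorm.pow_const _).aemeasurable]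
  congr 1
  refine lintegral_congr fun t => ?_
  rw [← ENNReal.rpow_mul, one_div, inv_mul_cancel₀ hpr.ne', ENNReal.rpow_one]

variable [NormedSpace ℝ E] [NormedSpace ℝ F]

lemma stronglyMeasurable_weighted {χ : ℝ → ℝ} (hχ : Measurable χ) (a : ℝ) {f : SpaceTime → E}
    (hf : StronglyMeasurable f) : StronglyMeasurable (weighted χ a f) := by
  refine StronglyMeasurable.smul (Measurable.stronglyMeasurable ?_) hf
  exact (hχ.comp measurable_snd.norm).mul (measurable_snd.norm.pow_const a)

lemma RadialCutoffs.measurable_bump (χ : RadialCutoffs) (ℓ : ℤ) : Measurable (χ.bump ℓ) :=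
  (χ.bump_smooth ℓ).continuous.measurable

/-- If two shells share a point then `2^ℓ ≤ c² 2^m` and conversely, so their indices differ by at
most any `n` with `c² < 2^n`. -/
lemma RadialCutoffs.exists_overlap (χ : RadialCutoffs) :
    ∃ M : ℤ, ∀ ℓ j r, χ.bump (ℓ + j) r ≠ 0 → χ.bump ℓ r ≠ 0 → j ∈ Finset.Icc (-M) M := by
  obtain ⟨n, hn⟩ := pow_unbounded_of_one_lt (χ.c * χ.c) (show (1 : ℝ) < 2 by norm_num)
  have hc : 0 < χ.c := zero_lt_one.trans_le χ.one_le_c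
  have key : ∀ (ℓ m : ℤ) (r : ℝ), χ.bump ℓ r ≠ 0 → χ.bump m r ≠ 0 → ℓ - m ≤ n := by
    intro ℓ m r h1 h2
    have h3 := (χ.bump_support ℓ r h1).1.trans (χ.bump_support m r h2).2
    rw [div_le_iff₀ hc] at h3
    have h4 : (2 : ℝ) ^ ℓ < (2 : ℝ) ^ ((n : ℤ) + m) := by
      rw [zpow_add₀ two_ne_zero, zpow_natCast]
      calc (2 : ℝ) ^ ℓ ≤ χ.c * χ.c * 2 ^ m := by linarith
        _ < _ := by gcongr
    have := (zpow_lt_zpow_iff_right₀ (show (1 : ℝ) < 2 by norm_num)).1 h4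
    omega
  refine ⟨n, fun ℓ j r h1 h2 => ?_⟩
  have a := key _ _ r h1 h2
  have b := key _ _ r h2 h1
  rw [Finset.mem_Icc]
  constructor <;> omega

lemma RadialCutoffs.tsum_bump (χ : RadialCutoffs) {r : ℝ} (hr : 0 < r) :
    ∑' ℓ, ENNReal.ofReal (χ.bump ℓ r) = 1 := by
  have h := χ.bump_sum r hr
  rw [← ENNReal.ofReal_tsum_of_nonneg (fun ℓ => χ.bump_nonneg ℓ r) h.summable, h.tsum_eq,
    ENNReal.ofReal_one]

lemma enorm_weighted (χ : RadialCutoffs) (ℓ : ℤ) (a : ℝ) (f : SpaceTime → E) {z : SpaceTime}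
    (hz : z.2 ≠ 0) : ‖weighted (χ.bump ℓ) a f z‖ₑ =
      ENNReal.ofReal (χ.bump ℓ ‖z.2‖) * ENNReal.ofReal ‖z.2‖ ^ a * ‖f z‖ₑ := by
  have hz : 0 < ‖z.2‖ := norm_pos_iff.2 hz
  rw [weighted, mul_smul, enorm_smul, Real.enorm_of_nonneg (χ.bump_nonneg _ _), enorm_rpow_smul hz,
    mul_assoc]

lemma ae_snd_ne_zero : ∀ᵐ z : SpaceTime, z.2 ≠ 0 := by
  have h : ∀ᵐ x : Plane, x ≠ 0 := by simp [ae_iff]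
  exact Measure.quasiMeasurePreserving_snd.ae h

/-- The interaction estimate in which one factor is summed over dyadic shells. -/
lemma RadialCutoffs.exists_shell_bound (χ : RadialCutoffs) :
    ∃ N : ℕ, ∀ (ψ : SpaceTime → E) (ζ : SpaceTime → F), StronglyMeasurable ψ →
      StronglyMeasurable ζ → eLpNorm (fun z => ‖ψ z‖ₑ * ‖ζ z‖ₑ) (3 / 2) volume ≤
        N * ((⨆ ℓ : ℤ, mixedNorm 2 2 (weighted (χ.bump ℓ) (-(1 / 2)) ψ)) *
          ∑' ℓ : ℤ, mixedNorm 6 6 (weighted (χ.bump ℓ) (1 / 2) ζ)) := by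
  obtain ⟨M, hM⟩ := χ.exists_overlap
  refine ⟨(Finset.Icc (-M) M).card, fun ψ ζ hψ hζ => ?_⟩
  set f : ℤ → SpaceTime → E := fun ℓ => weighted (χ.bump ℓ) (-(1 / 2)) ψ
  set g : ℤ → SpaceTime → F := fun ℓ => weighted (χ.bump ℓ) (1 / 2) ζ
  have hf : ∀ ℓ, StronglyMeasurable (f ℓ) := fun ℓ =>
    stronglyMeasurable_weighted (χ.measurable_bump ℓ) _ hψ
  have hg : ∀ ℓ, StronglyMeasurable (g ℓ) := fun ℓ =>
    stronglyMeasurable_weighted (χ.measurable_bump ℓ) _ hζ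
  have hle : (1 : ℝ≥0∞) ≤ 3 / 2 := by
    rw [ENNReal.le_div_iff_mul_le (by simp) (by simp)]; norm_num
  have hne : (3 / 2 : ℝ≥0∞) ≠ ⊤ := by simp [ENNReal.div_eq_top]
  -- The partition of unity is inserted twice and the double sum is arranged by the offset `j`
  -- between the shells. Only boundedly many offsets survive, so `ψ` needs a supremum over shells
  -- and only `ζ` a sum.
  have hpt : ∀ᵐ z : SpaceTime, ‖ψ z‖ₑ * ‖ζ z‖ₑ =
      ∑ j ∈ Finset.Icc (-M) M, ∑' ℓ, ‖f (ℓ + j) z‖ₑ * ‖g ℓ z‖ₑ := by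
    filter_upwards [ae_snd_ne_zero] with z hz
    have hr : 0 < ‖z.2‖ := norm_pos_iff.2 hz
    set x := ENNReal.ofReal ‖z.2‖ with hx
    have hx0 : x ≠ 0 := by simpa [hx] using hz
    have hx1 : x ≠ ⊤ := ENNReal.ofReal_ne_top
    have hprod : ∀ m ℓ, ‖f m z‖ₑ * ‖g ℓ z‖ₑ = ENNReal.ofReal (χ.bump m ‖z.2‖) *
        (ENNReal.ofReal (χ.bump ℓ ‖z.2‖) * (‖ψ z‖ₑ * ‖ζ z‖ₑ)) := by
      intro m ℓ
      have e : x ^ (-(1 / 2) : ℝ) * x ^ (1 / 2 : ℝ) = 1 := by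
        rw [← ENNReal.rpow_add _ _ hx0 hx1]; simp
      simp only [f, g, enorm_weighted χ _ _ _ hz, ← hx]
      calc _ = (x ^ (-(1 / 2) : ℝ) * x ^ (1 / 2 : ℝ)) * (ENNReal.ofReal (χ.bump m ‖z.2‖) *
            (ENNReal.ofReal (χ.bump ℓ ‖z.2‖) * (‖ψ z‖ₑ * ‖ζ z‖ₑ))) := by ring
        _ = _ := by rw [e, one_mul]
    calc ‖ψ z‖ₑ * ‖ζ z‖ₑ = ∑' ℓ, ∑' m, ‖f m z‖ₑ * ‖g ℓ z‖ₑ := by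
          simp_rw [hprod, ENNReal.tsum_mul_right, χ.tsum_bump hr, one_mul, ENNReal.tsum_mul_right,
            χ.tsum_bump hr, one_mul]
      _ = ∑' ℓ, ∑' j, ‖f (ℓ + j) z‖ₑ * ‖g ℓ z‖ₑ :=
          tsum_congr fun ℓ => ((Equiv.addLeft ℓ).tsum_eq fun m => ‖f m z‖ₑ * ‖g ℓ z‖ₑ).symm
      _ = ∑' ℓ, ∑ j ∈ Finset.Icc (-M) M, ‖f (ℓ + j) z‖ₑ * ‖g ℓ z‖ₑ := by
          refine tsum_congr fun ℓ => tsum_eq_sum fun j hj => ?_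
          by_contra h0
          rw [hprod] at h0
          refine hj (hM ℓ j ‖z.2‖ ?_ ?_)
          · rintro h; simp [h] at h0
          · rintro h; simp [h] at h0
      _ = _ := Summable.tsum_finsetSum fun _ _ => ENNReal.summable
  have hterm : ∀ j : ℤ, eLpNorm (fun z => ∑' ℓ, ‖f (ℓ + j) z‖ₑ * ‖g ℓ z‖ₑ) (3 / 2) volume ≤
      (⨆ ℓ, mixedNorm 2 2 (f ℓ)) * ∑' ℓ, mixedNorm 6 6 (g ℓ) := by
    intro j
    refine (eLpNorm_tsum_le (fun ℓ => ((hf _).enorm.mul (hg _).enorm).aemeasurable) hle hne).trans ?_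
    rw [← ENNReal.tsum_mul_left]
    refine ENNReal.tsum_le_tsum fun ℓ => ?_
    refine (eLpNorm_enorm_mul_enorm_le (p := 2) (q := 6) (hf _).aestronglyMeasurable
      (hg _).aestronglyMeasurable).trans ?_
    rw [← mixedNorm_self (hf _) (by simp) (by simp), ← mixedNorm_self (hg _) (by simp) (by simp)]
    gcongr
    exact le_iSup (fun ℓ => mixedNorm 2 2 (f ℓ)) (ℓ + j)
  rw [eLpNorm_congr_ae hpt]
  have hsum := eLpNorm_sum_le (μ := (volume : Measure SpaceTime)) (s := Finset.Icc (-M) M)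
    (f := fun (j : ℤ) z => ∑' ℓ, ‖f (ℓ + j) z‖ₑ * ‖g ℓ z‖ₑ) (p := 3 / 2)
    (fun j _ => (Measurable.tsum fun ℓ =>
      (hf _).enorm.mul (hg _).enorm).aestronglyMeasurable) hle
  calc _ = eLpNorm (∑ j ∈ Finset.Icc (-M) M, fun z => ∑' ℓ, ‖f (ℓ + j) z‖ₑ * ‖g ℓ z‖ₑ)
        (3 / 2) volume := by
        congr 1
        ext z
        simp
    _ ≤ _ := hsum
    _ ≤ ∑ _j ∈ Finset.Icc (-M) M, (⨆ ℓ, mixedNorm 2 2 (f ℓ)) * ∑' ℓ, mixedNorm 6 6 (g ℓ) :=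
        Finset.sum_le_sum fun j _ => hterm j
    _ = _ := by rw [Finset.sum_const, nsmul_eq_mul]

end

/-! ### Rotations, the angular derivative and the null structure -/

/-- The rotation of the plane by the angle `s`. -/
def planeRotation (s : ℝ) : Plane ≃ₗᵢ[ℝ] Plane :=
  (Complex.orthonormalBasisOneI.repr.symm.trans (rotation (Circle.exp s))).trans
    Complex.orthonormalBasisOneI.repr

/-- The rotation of the plane by a right angle. -/
def quarterTurn : Plane →L[ℝ] Plane :=
  Complex.orthonormalBasisOneI.repr.toContinuousLinearEquiv.toContinuousLinearMap ∘L
    ContinuousLinearMap.mul ℝ ℂ Complex.I ∘L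
    Complex.orthonormalBasisOneI.repr.symm.toContinuousLinearEquiv.toContinuousLinearMap

/-- The rotation by the angle `s` in the space variables. -/
def spaceRotation (s : ℝ) : SpaceTime ≃ₜ SpaceTime :=
  (Homeomorph.refl ℝ).prodCongr (planeRotation s).toHomeomorph

/-- The velocity `x ↦ (0, Jx)` of the rotations in the space variables. -/
def rotationField : SpaceTime →L[ℝ] SpaceTime :=
  (0 : SpaceTime →L[ℝ] ℝ).prod (quarterTurn ∘L ContinuousLinearMap.snd ℝ ℝ Plane)

lemma spaceRotation_apply (s : ℝ) (z : SpaceTime) :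
    spaceRotation s z = (z.1, planeRotation s z.2) := rfl

lemma norm_spaceRotation (s : ℝ) (z : SpaceTime) : ‖spaceRotation s z‖ = ‖z‖ := by
  rw [spaceRotation_apply, Prod.norm_def, Prod.norm_def, LinearIsometryEquiv.norm_map]

lemma spaceRotation_zero (z : SpaceTime) : spaceRotation 0 z = z := by
  simp [spaceRotation_apply, planeRotation]

lemma measurePreserving_spaceRotation (s : ℝ) : MeasurePreserving (spaceRotation s) :=
  (MeasurePreserving.id volume).prod (planeRotation s).measurePreserving

lemma hasDerivAt_spaceRotation (s : ℝ) (z : SpaceTime) :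
    HasDerivAt (fun s => spaceRotation s z) (rotationField (spaceRotation s z)) s := by
  have h1 : HasDerivAt (fun s : ℝ => Complex.exp (s * Complex.I) *
      Complex.orthonormalBasisOneI.repr.symm z.2)
      (Complex.exp (s * Complex.I) * (1 * Complex.I) *
      Complex.orthonormalBasisOneI.repr.symm z.2) s :=
    ((((hasDerivAt_id s).ofReal_comp.mul_const Complex.I)).cexp).mul_const _
  have h2 := (Complex.orthonormalBasisOneI.repr.toContinuousLinearEquiv.toContinuousLinearMap
    |>.hasFDerivAt).comp_hasDerivAt s h1
  refine ((hasDerivAt_const s z.1).prodMk h2).congr_deriv ?_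
  refine Prod.ext rfl ?_
  simp [rotationField, quarterTurn, spaceRotation_apply, planeRotation, mul_assoc, mul_left_comm]

lemma quarterTurn_apply (x : Plane) :
    quarterTurn x = x 0 • EuclideanSpace.single 1 (1 : ℝ) - x 1 • EuclideanSpace.single 0 (1 : ℝ) := by
  ext i
  have h : ∀ w : ℂ, ⇑(Complex.orthonormalBasisOneI.repr w) = ![w.re, w.im] := fun w =>
    Complex.orthonormalBasisOneI_repr_apply w
  fin_cases i <;>
  simp [quarterTurn, h, Complex.orthonormalBasisOneI_repr_symm_apply]

lemma coordDir_one : coordDir 1 = ((0 : ℝ), EuclideanSpace.single (0 : Fin 2) (1 : ℝ)) := rfl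

lemma coordDir_two : coordDir 2 = ((0 : ℝ), EuclideanSpace.single (1 : Fin 2) (1 : ℝ)) := rfl

lemma rotationField_apply (z : SpaceTime) :
    rotationField z = z.2 0 • coordDir 2 - z.2 1 • coordDir 1 := by
  refine Prod.ext ?_ ?_
  · simp [rotationField, coordDir_one, coordDir_two]
  · change quarterTurn z.2 = _
    rw [quarterTurn_apply]
    rfl

section

variable {E : Type*} [NormedAddCommGroup E] [NormedSpace ℝ E]

/-- Radial functions are annihilated by the angular derivative, in the weak sense. -/
lemma IsRadial.integral_fderiv_rotationField {φ : SpaceTime → E} (hr : IsRadial φ)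
    (hφ : LocallyIntegrable φ volume) {η : SpaceTime → ℝ} (hη : ContDiff ℝ ∞ η)
    (hc : HasCompactSupport η) : ∫ z, fderiv ℝ η z (rotationField z) • φ z = 0 := by
  set D : SpaceTime → ℝ := fun z => fderiv ℝ η z (rotationField z) with hD
  have hDc : Continuous D := (hη.continuous_fderiv (by simp)).clm_apply rotationField.continuous
  have hDs : HasCompactSupport D := (hc.fderiv (𝕜 := ℝ)).mono fun z hz => by
    contrapose! hz
    simp only [Function.mem_support, not_not] at hz
    simp [hD, hz]
  obtain ⟨C, hC⟩ := hDs.exists_bound_of_continuous hDc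
  obtain ⟨R, hR⟩ := hDs.isCompact.isBounded.subset_closedBall (0 : SpaceTime)
  set K := Metric.closedBall (0 : SpaceTime) R with hK
  have hinv : ∀ (s : ℝ) z, φ (spaceRotation s z) = φ z := fun s z =>
    hr _ _ _ ((planeRotation s).norm_map z.2)
  -- Invariance of both `φ` and the measure moves the rotation off the test function.
  -- Differentiating this constant at `s = 0` gives the claim.
  have hconst : ∀ s : ℝ, ∫ z, η (spaceRotation s z) • φ z = ∫ z, η z • φ z := by
    intro s
    rw [← (measurePreserving_spaceRotation s).integral_comp
      (spaceRotation s).measurableEmbedding (fun z => η z • φ z)]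
    simp only [hinv]
  -- Rotations preserve the ball `K`, so a single integrable majorant serves every `s`.
  have hbound : ∀ (s : ℝ) z, ‖D (spaceRotation s z) • φ z‖ ≤ K.indicator (fun z => C * ‖φ z‖) z := by
    intro s z
    by_cases hz : z ∈ K
    · rw [indicator_of_mem hz, norm_smul]
      gcongr
      exact hC _
    · rw [indicator_of_notMem hz, norm_smul]
      have : spaceRotation s z ∉ tsupport D := fun h => hz <| by
        have := hR h
        rw [mem_closedBall_zero_iff, norm_spaceRotation] at this
        rwa [hK, mem_closedBall_zero_iff]
      rw [image_eq_zero_of_notMem_tsupport this]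
      simp
  have hKint : Integrable (K.indicator fun z => C * ‖φ z‖) volume := by
    rw [integrable_indicator_iff Metric.isClosed_closedBall.measurableSet]
    exact ((hφ.integrableOn_isCompact (isCompact_closedBall 0 R)).norm).const_mul C
  have hder := (hasDerivAt_integral_of_dominated_loc_of_deriv_le (𝕜 := ℝ) (μ := volume)
    (F := fun s z => η (spaceRotation s z) • φ z) (F' := fun s z => D (spaceRotation s z) • φ z)
    (x₀ := 0) (s := univ) (bound := K.indicator fun z => C * ‖φ z‖) Filter.univ_mem
    (.of_forall fun s => ((hη.continuous.comp
      (spaceRotation s).continuous).aestronglyMeasurable.smul hφ.aestronglyMeasurable))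
    (by
      simp only [spaceRotation_zero]
      exact hφ.integrable_smul_left_of_hasCompactSupport hη.continuous hc)
    ((hDc.comp (spaceRotation 0).continuous).aestronglyMeasurable.smul hφ.aestronglyMeasurable)
    (.of_forall fun z s _ => hbound s z) hKint
    (.of_forall fun z s _ => by
      have h1 := (hη.differentiable (by simp) (spaceRotation s z)).hasFDerivAt.comp_hasDerivAt s
        (hasDerivAt_spaceRotation s z)
      exact h1.smul_const (φ z))).2
  simp only [hconst, spaceRotation_zero] at hder
  exact hder.unique (hasDerivAt_const _ _)

variable {φ : SpaceTime → E} {g : SpaceTime → PiLp 2 (fun _ : Fin 3 => E)}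

lemma IsWeakGrad.locallyIntegrable_apply (h : IsWeakGrad φ g) (i : Fin 3) :
    LocallyIntegrable (fun z => g z i) volume :=
  h.locallyIntegrable_grad.mono
    ((PiLp.continuous_apply 2 _ i).comp_aestronglyMeasurable
      h.locallyIntegrable_grad.aestronglyMeasurable)
    (.of_forall fun z => PiLp.norm_apply_le (g z) i)

lemma locallyIntegrable_continuous_smul {f : SpaceTime → E} (hf : LocallyIntegrable f volume)
    {a : SpaceTime → ℝ} (ha : Continuous a) : LocallyIntegrable (fun z => a z • f z) volume := by
  rw [locallyIntegrable_iff]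
  exact fun K hK => (hf.integrableOn_isCompact hK).continuousOn_smul ha.continuousOn hK

/-- The weak gradient is tested against `x_j η`; direction `i` does not move `x_j`, so the product
rule leaves one term. Gradient index `0` is time, hence spatial coordinate `j` belongs to gradient
index `j + 1`. -/
lemma IsWeakGrad.integral_coord_mul (h : IsWeakGrad φ g) {η : SpaceTime → ℝ} (hη : ContDiff ℝ ∞ η)
    (hc : HasCompactSupport η) (j : Fin 2) (i : Fin 3) (hji : (coordDir i).2 j = 0) :
    ∫ z, η z • z.2 j • g z i = -∫ z, (z.2 j * fderiv ℝ η z (coordDir i)) • φ z := by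
  let L : SpaceTime →L[ℝ] ℝ := (EuclideanSpace.proj j : Plane →L[ℝ] ℝ) ∘L
    ContinuousLinearMap.snd ℝ ℝ Plane
  have hL : ∀ z, L z = z.2 j := fun z => rfl
  have key := h.integral_eq (fun z => L z * η z) (L.contDiff.mul hη) hc.mul_left i
  have e1 : ∀ z, fderiv ℝ (fun z => L z * η z) z (coordDir i) =
      z.2 j * fderiv ℝ η z (coordDir i) := by
    intro z
    rw [fderiv_fun_mul L.differentiableAt (hη.differentiable (by simp) z)]
    simp [hL, hji]
  simp only [e1] at key
  rw [← key]
  refine integral_congr_ae (.of_forall fun z => ?_)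
  simp only [hL, smul_smul, mul_comm]

/-- The gradient of a radial function has no angular part. -/
lemma IsWeakGrad.ae_angular_eq [CompleteSpace E] (h : IsWeakGrad φ g) (hr : IsRadial φ) :
    ∀ᵐ z : SpaceTime, z.2 0 • g z 2 = z.2 1 • g z 1 := by
  have hcoord : ∀ j : Fin 2, Continuous fun z : SpaceTime => z.2 j := fun j => by fun_prop
  have h0 := locallyIntegrable_continuous_smul (h.locallyIntegrable_apply 2) (hcoord 0)
  have h1 := locallyIntegrable_continuous_smul (h.locallyIntegrable_apply 1) (hcoord 1)
  have key := ae_eq_zero_of_integral_contDiff_smul_eq_zero (h0.sub h1) ?_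
  · filter_upwards [key] with z hz
    exact sub_eq_zero.1 hz
  intro η hη hc
  have hd : ∀ i, Continuous fun z => fderiv ℝ η z (coordDir i) := fun i =>
    (hη.continuous_fderiv (by simp)).clm_apply continuous_const
  have hint : ∀ j i, Integrable (fun z : SpaceTime =>
      (z.2 j * fderiv ℝ η z (coordDir i)) • φ z) volume := by
    intro j i
    refine h.locallyIntegrable.integrable_smul_left_of_hasCompactSupport ((hcoord j).mul (hd i)) ?_
    refine HasCompactSupport.mul_left ((hc.fderiv (𝕜 := ℝ)).mono fun z hz => ?_)
    contrapose! hz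
    simp only [Function.mem_support, not_not] at hz
    simp [hz]
  calc _ = ∫ z, (η z • z.2 0 • g z 2 - η z • z.2 1 • g z 1) := by
        simp only [Pi.sub_apply, smul_sub]
    _ = -∫ z, ((z.2 0 * fderiv ℝ η z (coordDir 2)) • φ z -
          (z.2 1 * fderiv ℝ η z (coordDir 1)) • φ z) := by
        rw [integral_sub (h0.integrable_smul_left_of_hasCompactSupport hη.continuous hc)
          (h1.integrable_smul_left_of_hasCompactSupport hη.continuous hc),
          h.integral_coord_mul hη hc 0 2 (by simp [coordDir_two]),
          h.integral_coord_mul hη hc 1 1 (by simp [coordDir_one]), integral_sub (hint 0 2) (hint 1 1)]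
        abel
    _ = -∫ z, fderiv ℝ η z (rotationField z) • φ z := by
        congr 1
        refine integral_congr_ae (.of_forall fun z => ?_)
        simp only [rotationField_apply, map_sub, map_smul, smul_eq_mul, sub_smul]
    _ = 0 := by rw [hr.integral_fderiv_rotationField h.locallyIntegrable hη hc, neg_zero]

/-- A vanishing angular component makes the spatial gradient equal to its projection onto `x / |x|`.
The identity is checked after multiplication by `|x|²`, which clears the denominators. -/
lemma IsWeakGrad.ae_eq_radialDeriv [CompleteSpace E] (h : IsWeakGrad φ g) (hr : IsRadial φ) :
    ∀ᵐ z : SpaceTime, ∀ j : Fin 2, g z j.succ = (z.2 j / ‖z.2‖) • radialDeriv g z := by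
  filter_upwards [h.ae_angular_eq hr, ae_snd_ne_zero] with z hz hne j
  have hn : ‖z.2‖ ≠ 0 := norm_ne_zero_iff.2 hne
  have hsq : ‖z.2‖ ^ 2 = z.2 0 ^ 2 + z.2 1 ^ 2 := by
    rw [EuclideanSpace.real_norm_sq_eq, Fin.sum_univ_two]
  have e : ‖z.2‖ ^ 2 • ((z.2 j / ‖z.2‖) • radialDeriv g z) =
      z.2 j • z.2 0 • g z 1 + z.2 j • z.2 1 • g z 2 := by
    simp only [radialDeriv, Fin.sum_univ_two, smul_add, smul_smul]
    congr 2 <;> field_simp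
  have hinj : Function.Injective fun v : E => ‖z.2‖ ^ 2 • v :=
    smul_right_injective E (pow_ne_zero 2 hn)
  refine hinj ?_
  simp only
  rw [e, hsq, add_smul]
  fin_cases j
  · simp only [Fin.zero_eta, Fin.succ_zero_eq_one]
    rw [smul_comm (z.2 0) (z.2 1) (g z 2), hz, smul_smul, smul_smul, pow_two, pow_two]
  · simp only [Fin.mk_one, Fin.succ_one_eq_two]
    rw [smul_comm (z.2 1) (z.2 0) (g z 1), ← hz, smul_smul, smul_smul, pow_two, pow_two]

variable {F G : Type*} [NormedAddCommGroup F] [NormedSpace ℝ F] [NormedAddCommGroup G]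
  [NormedSpace ℝ G]

/-- For radial functions the null form only pairs outgoing with incoming derivatives. -/
lemma ae_nullForm_eq [CompleteSpace E] [CompleteSpace F] (B : E →L[ℝ] F →L[ℝ] G)
    {φ' : SpaceTime → F} {g' : SpaceTime → PiLp 2 (fun _ : Fin 3 => F)} (h : IsWeakGrad φ g)
    (hr : IsRadial φ) (h' : IsWeakGrad φ' g') (hr' : IsRadial φ') :
    ∀ᵐ z : SpaceTime, nullForm B g g' z = -((1 / 2 : ℝ) •
      (B (g z 0 + radialDeriv g z) (g' z 0 - radialDeriv g' z) +
        B (g z 0 - radialDeriv g z) (g' z 0 + radialDeriv g' z))) := by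
  filter_upwards [h.ae_eq_radialDeriv hr, h'.ae_eq_radialDeriv hr', ae_snd_ne_zero] with z h1 h2 hne
  have hn : ‖z.2‖ ≠ 0 := norm_ne_zero_iff.2 hne
  have hsq : ‖z.2‖ ^ 2 = z.2 0 ^ 2 + z.2 1 ^ 2 := by
    rw [EuclideanSpace.real_norm_sq_eq, Fin.sum_univ_two]
  have hone : (z.2 0 / ‖z.2‖) * (z.2 0 / ‖z.2‖) + (z.2 1 / ‖z.2‖) * (z.2 1 / ‖z.2‖) = 1 := by
    field_simp
    linarith
  have hsum : ∑ j : Fin 2, B (g z j.succ) (g' z j.succ) = B (radialDeriv g z) (radialDeriv g' z) := by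
    simp only [h1, h2, map_smul, smul_apply, smul_smul, ← Finset.sum_smul]
    rw [Fin.sum_univ_two, hone, one_smul]
  rw [nullForm, hsum]
  simp only [map_add, map_sub, add_apply, sub_apply]
  module

end

/-! ### Interpolation and the exponents at which the norms are used -/

lemma twoPow_add (a b : ℝ) : twoPow (a + b) = twoPow a * twoPow b := by
  rw [twoPow, twoPow, twoPow, ← ENNReal.ofReal_mul (by positivity), Real.rpow_add two_pos]

lemma twoPow_zero : twoPow 0 = 1 := by simp [twoPow]

lemma twoPow_ne_top (a : ℝ) : twoPow a ≠ ⊤ := ENNReal.ofReal_ne_top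

lemma twoPow_rpow (a b : ℝ) : twoPow a ^ b = twoPow (b * a) := by
  rw [twoPow, twoPow, ENNReal.ofReal_rpow_of_pos (by positivity), ← Real.rpow_mul two_pos.le,
    mul_comm]

/-- For finite `p`, integrate `|f|^p ≤ |f|^{3/2} M^{p - 3/2}`. -/
lemma eLpNorm_le_interpolate {α E : Type*} [MeasurableSpace α] {μ : Measure α}
    [NormedAddCommGroup E] {f : α → E} {A M : ℝ≥0∞} (hA : eLpNorm f (3 / 2) μ ≤ A)
    (hM : eLpNorm f ⊤ μ ≤ M) (hM' : M ≠ ⊤) {p : ℝ≥0∞} (hp : 3 / 2 ≤ p) :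
    eLpNorm f p μ ≤ A ^ (3 / 2 * (p⁻¹).toReal) * M ^ (1 - 3 / 2 * (p⁻¹).toReal) := by
  rcases eq_or_ne p ⊤ with rfl | hp'
  · simpa using hM
  have h32 : (3 / 2 : ℝ≥0∞).toReal = 3 / 2 := by simp
  have hp₀ : p ≠ 0 := ((ENNReal.div_pos (by simp) (by simp)).trans_le hp).ne'
  have hpr : 3 / 2 ≤ p.toReal := by
    rw [← h32]; exact ENNReal.toReal_mono hp' hp
  have hpos : 0 < p.toReal := by linarith
  have h1 : ∫⁻ x, ‖f x‖ₑ ^ (3 / 2 : ℝ) ∂μ ≤ A ^ (3 / 2 : ℝ) := by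
    rw [eLpNorm_eq_lintegral_rpow_enorm_toReal (by simp) (by simp [ENNReal.div_eq_top]), h32,
      one_div, ENNReal.rpow_inv_le_iff (by norm_num)] at hA
    exact hA
  have h2 : ∫⁻ x, ‖f x‖ₑ ^ p.toReal ∂μ ≤ A ^ (3 / 2 : ℝ) * M ^ (p.toReal - 3 / 2) := by
    calc _ ≤ ∫⁻ x, ‖f x‖ₑ ^ (3 / 2 : ℝ) * M ^ (p.toReal - 3 / 2) ∂μ := by
          refine lintegral_mono_ae ?_
          filter_upwards [eLpNorm_top_le_iff.1 hM] with x hx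
          calc ‖f x‖ₑ ^ p.toReal = ‖f x‖ₑ ^ (3 / 2 : ℝ) * ‖f x‖ₑ ^ (p.toReal - 3 / 2) := by
                rw [← ENNReal.rpow_add_of_nonneg _ _ (by norm_num) (by linarith)]
                congr 1
                ring
            _ ≤ _ := by
                gcongr
      _ = (∫⁻ x, ‖f x‖ₑ ^ (3 / 2 : ℝ) ∂μ) * M ^ (p.toReal - 3 / 2) :=
          lintegral_mul_const' _ _ (ENNReal.rpow_ne_top_of_nonneg (by linarith) hM')
      _ ≤ _ := by gcongr
  rw [eLpNorm_eq_lintegral_rpow_enorm_toReal hp₀ hp']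
  calc _ ≤ (A ^ (3 / 2 : ℝ) * M ^ (p.toReal - 3 / 2)) ^ (1 / p.toReal) := by gcongr
    _ = _ := by
      rw [ENNReal.mul_rpow_of_nonneg _ _ (by positivity), ← ENNReal.rpow_mul, ← ENNReal.rpow_mul,
        ENNReal.toReal_inv, one_div]
      congr 2
      field_simp

section

variable {E F G : Type*} [NormedAddCommGroup E] [NormedAddCommGroup F] [NormedAddCommGroup G]

/-- A bound for almost every `t` and then almost every `x` gives a joint one only when the
exceptional set is measurable, whence the passage through a strongly measurable representative. -/
lemma eLpNorm_top_le_mixedNorm {f : SpaceTime → E} (hf : AEStronglyMeasurable f volume) :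
    eLpNorm f ⊤ volume ≤ mixedNorm ⊤ ⊤ f := by
  set c := mixedNorm ⊤ ⊤ f with hc
  have h1 : ∀ᵐ t : ℝ, ∀ᵐ x : Plane, ‖f (t, x)‖ₑ ≤ c := by
    have h : eLpNormEssSup (fun t : ℝ => eLpNorm (fun x : Plane => f (t, x)) ⊤ volume) volume ≤ c :=
      (by rw [← eLpNorm_exponent_top]; exact hc.ge)
    filter_upwards [ae_le_eLpNormEssSup (f := fun t : ℝ =>
      eLpNorm (fun x : Plane => f (t, x)) ⊤ volume) (μ := volume)] with t ht
    exact eLpNorm_top_le_iff.1 (ht.trans h)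
  have h2 : ∀ᵐ t : ℝ, ∀ᵐ x : Plane, f (t, x) = hf.mk f (t, x) :=
    Measure.ae_ae_of_ae_prod hf.ae_eq_mk
  have h3 : ∀ᵐ z : SpaceTime, ‖hf.mk f z‖ₑ ≤ c := by
    refine (Measure.ae_prod_iff_ae_ae (μ := volume) (ν := volume)
      (measurableSet_le hf.stronglyMeasurable_mk.enorm measurable_const)).2 ?_
    filter_upwards [h1, h2] with t ht1 ht2
    filter_upwards [ht1, ht2] with x hx1 hx2
    rwa [← hx2]
  rw [eLpNorm_top_le_iff]
  filter_upwards [h3, hf.ae_eq_mk] with z hz1 hz2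
  rwa [hz2]

variable [NormedSpace ℝ E] [NormedSpace ℝ F] [NormedSpace ℝ G]

lemma iSup_mixedNorm_le_yNorm (χ : RadialCutoffs) (δ : ℝ) (k : ℤ) (ψ : SpaceTime → E) :
    ⨆ ℓ : ℤ, mixedNorm 2 2 (weighted (χ.bump ℓ) (-(1 / 2)) ψ) ≤ yNorm χ δ k ψ :=
  le_add_self

/-- The choice `q = p = 6`, `λ = 1/2` is scale invariant: `1/6 + 2/6 - 1 + 1/2 = 0`. It is
admissible because `1/3 + δ ≤ 1/2`. -/
lemma tsum_mixedNorm_le_shellNorm (χ : RadialCutoffs) {δ : ℝ} (hδ₀ : 0 ≤ δ) (hδ₁ : δ ≤ 1 / 10)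
    (k : ℤ) (ψ : SpaceTime → E) :
    ∑' ℓ : ℤ, mixedNorm 6 6 (weighted (χ.bump ℓ) (1 / 2) ψ) ≤ shellNorm χ δ k ψ := by
  have h6 : (6⁻¹ : ℝ≥0∞) = ENNReal.ofReal (1 / 6) := by
    rw [one_div, ENNReal.ofReal_inv_of_pos (by norm_num)]; simp
  have h2 : (2⁻¹ : ℝ≥0∞) = ENNReal.ofReal (1 / 2) := by
    rw [one_div, ENNReal.ofReal_inv_of_pos (by norm_num)]; simp
  have hadm : Admissible δ 6 6 := by
    refine ⟨by norm_num, by norm_num, ?_, ?_⟩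
    · rw [h6, h2, ← ENNReal.ofReal_add (by norm_num) (by norm_num)]
      exact (ENNReal.ofReal_lt_ofReal_iff (by norm_num)).2 (by norm_num)
    · rw [h6, h2, ← ENNReal.ofReal_add (by norm_num) (by norm_num),
        ← ENNReal.ofReal_add (by norm_num) hδ₀]
      exact ENNReal.ofReal_le_ofReal (by linarith)
  have hw : (1 / 2 : ℝ) ∈ weights δ := by
    refine ⟨⟨by norm_num, by norm_num⟩, by linarith, by linarith⟩
  have hone : twoPow (strichartzExp 6 6 * k) * twoPow (1 / 2 * k) = 1 := by
    rw [← twoPow_add, ← twoPow_zero]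
    congr 1
    simp only [strichartzExp, ENNReal.toReal_inv, ENNReal.toReal_ofNat]
    ring
  calc _ = twoPow (strichartzExp 6 6 * k) * twoPow (1 / 2 * k) *
        ∑' ℓ : ℤ, mixedNorm 6 6 (weighted (χ.bump ℓ) (1 / 2) ψ) := by rw [hone, one_mul]
    _ ≤ _ := by
        rw [shellNorm]
        refine le_iSup_of_le 6 <| le_iSup_of_le 6 <| le_iSup_of_le hadm ?_
        exact le_iSup_of_le (1 / 2) <| le_iSup_of_le hw le_rfl

/-- The strict inequality supplies a near-optimal decomposition, since the infimum need not be
attained. At `λ = 1/2` the null norm has no frequency factor. -/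
lemma exists_of_zNormPlus_lt {χ : RadialCutoffs} {δ : ℝ} (hδ₀ : 0 ≤ δ) (hδ₁ : δ ≤ 1 / 10) {k : ℤ}
    {ψ : SpaceTime → E} {S : ℝ≥0∞} (h : zNormPlus χ δ k ψ < S) :
    ∃ ψp ψm, IsRadialDecomp ψ ψp ψm ∧ nullNormPlus (1 / 2) ψp ≤ S ∧
      (⨆ ℓ : ℤ, mixedNorm 2 2 (weighted (χ.bump ℓ) (-(1 / 2)) ψp)) ≤ S ∧
      (∑' ℓ : ℤ, mixedNorm 6 6 (weighted (χ.bump ℓ) (1 / 2) ψm)) ≤ S ∧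
      (⨆ ℓ : ℤ, mixedNorm 2 2 (weighted (χ.bump ℓ) (-(1 / 2)) ψm)) ≤ S := by
  simp only [zNormPlus, iInf_lt_iff] at h
  obtain ⟨ψp, ψm, hd, h⟩ := h
  refine ⟨ψp, ψm, hd, ?_, ?_, ?_, ?_⟩
  · refine le_trans ?_ ((le_self_add.trans le_self_add).trans h.le)
    refine le_iSup_of_le (1 / 2) <| le_iSup_of_le ⟨by norm_num, le_rfl⟩ ?_
    simp [twoPow_zero]
  · exact (iSup_mixedNorm_le_yNorm χ δ k ψp).trans ((le_add_self.trans le_self_add).trans h.le)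
  · exact (tsum_mixedNorm_le_shellNorm χ hδ₀ hδ₁ k ψm).trans
      ((le_self_add.trans le_add_self).trans h.le)
  · exact (iSup_mixedNorm_le_yNorm χ δ k ψm).trans ((le_add_self.trans le_add_self).trans h.le)

lemma exists_of_zNormMinus_lt {χ : RadialCutoffs} {δ : ℝ} (hδ₀ : 0 ≤ δ) (hδ₁ : δ ≤ 1 / 10) {k : ℤ}
    {ψ : SpaceTime → E} {S : ℝ≥0∞} (h : zNormMinus χ δ k ψ < S) :
    ∃ ψp ψm, IsRadialDecomp ψ ψp ψm ∧ nullNormMinus (1 / 2) ψm ≤ S ∧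
      (⨆ ℓ : ℤ, mixedNorm 2 2 (weighted (χ.bump ℓ) (-(1 / 2)) ψm)) ≤ S ∧
      (∑' ℓ : ℤ, mixedNorm 6 6 (weighted (χ.bump ℓ) (1 / 2) ψp)) ≤ S := by
  simp only [zNormMinus, iInf_lt_iff] at h
  obtain ⟨ψp, ψm, hd, h⟩ := h
  refine ⟨ψp, ψm, hd, ?_, ?_, ?_⟩
  · refine le_trans ?_ ((le_self_add.trans le_add_self).trans h.le)
    refine le_iSup_of_le (1 / 2) <| le_iSup_of_le ⟨by norm_num, le_rfl⟩ ?_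
    simp [twoPow_zero]
  · exact (iSup_mixedNorm_le_yNorm χ δ k ψm).trans ((le_add_self.trans le_add_self).trans h.le)
  · exact (tsum_mixedNorm_le_shellNorm χ hδ₀ hδ₁ k ψp).trans
      ((le_self_add.trans le_self_add).trans h.le)

lemma one_le_three_halves : (1 : ℝ≥0∞) ≤ 3 / 2 := by
  rw [ENNReal.le_div_iff_mul_le (by simp) (by simp)]; norm_num

lemma eLpNorm_mul_le_of_nullNorm {ψ : SpaceTime → E} {ζ : SpaceTime → F}
    (hψ : StronglyMeasurable ψ) (hζ : StronglyMeasurable ζ) (hψr : IsRadial ψ) (hζr : IsRadial ζ)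
    {S T : ℝ≥0∞} (hS₀ : S ≠ 0) (hS : S ≠ ⊤) (hT₀ : T ≠ 0) (hT : T ≠ ⊤)
    (hψS : nullNormPlus (1 / 2) ψ ≤ S) (hζT : nullNormMinus (1 / 2) ζ ≤ T) :
    eLpNorm (fun z => ‖ψ z‖ₑ * ‖ζ z‖ₑ) (3 / 2) volume ≤
      (ENNReal.ofReal (2 * Real.pi) * 8) ^ (2 / 3 : ℝ) * (S * T) := by
  have h := lintegral_mul_le_of_nullNorm hψ hζ hψr hζr hS₀ hS hT₀ hT hψS hζT
  have h32 : (3 / 2 : ℝ≥0∞).toReal = 3 / 2 := by simp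
  rw [eLpNorm_eq_lintegral_rpow_enorm_toReal (by simp) (by simp [ENNReal.div_eq_top]), h32]
  simp only [enorm_eq_self]
  calc _ ≤ (ENNReal.ofReal (2 * Real.pi) * 8 * (S * T) ^ (3 / 2 : ℝ)) ^ (1 / (3 / 2) : ℝ) := by
        gcongr
    _ = _ := by
        rw [ENNReal.mul_rpow_of_nonneg _ _ (by norm_num), ← ENNReal.rpow_mul]
        norm_num

/-- The product of an outgoing and an incoming derivative is bounded in `L^{3/2}`. -/
lemma RadialCutoffs.exists_zNorm_bound (χ : RadialCutoffs) {δ : ℝ} (hδ₀ : 0 ≤ δ)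
    (hδ₁ : δ ≤ 1 / 10) :
    ∃ C : NNReal, ∀ (k k' : ℤ) (ψ : SpaceTime → E) (ζ : SpaceTime → F) (S T : ℝ≥0∞),
      S ≠ ⊤ → T ≠ ⊤ → zNormPlus χ δ k ψ < S → zNormMinus χ δ k' ζ < T →
      eLpNorm (fun z => ‖ψ z‖ₑ * ‖ζ z‖ₑ) (3 / 2) volume ≤ C * (S * T) := by
  obtain ⟨N, hN⟩ := χ.exists_shell_bound (E := E) (F := F)
  obtain ⟨N', hN'⟩ := χ.exists_shell_bound (E := F) (F := E)
  set C₀ : ℝ≥0∞ := (ENNReal.ofReal (2 * Real.pi) * 8) ^ (2 / 3 : ℝ) with hC₀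
  have hC₀' : C₀ ≠ ⊤ := ENNReal.rpow_ne_top_of_nonneg (by norm_num)
    (ENNReal.mul_ne_top ENNReal.ofReal_ne_top (by simp))
  refine ⟨C₀.toNNReal + N + N + N', fun k k' ψ ζ S T hS hT hψ hζ => ?_⟩
  obtain ⟨ψp, ψm, ⟨hpm, hmm, hpr, -, hψe⟩, h1, h2, h3, h4⟩ := exists_of_zNormPlus_lt hδ₀ hδ₁ hψ
  obtain ⟨ζp, ζm, ⟨hpm', hmm', -, hmr', hζe⟩, h1', h2', h3'⟩ := exists_of_zNormMinus_lt hδ₀ hδ₁ hζ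
  have b1 : eLpNorm (fun z => ‖ψp z‖ₑ * ‖ζm z‖ₑ) (3 / 2) volume ≤ C₀ * (S * T) :=
    eLpNorm_mul_le_of_nullNorm hpm hmm' hpr hmr' (zero_le.trans_lt hψ).ne' hS
      (zero_le.trans_lt hζ).ne' hT h1 h1'
  -- In the remaining three products the second factor listed is the one summed over shells; for
  -- `ψm` and `ζm` this is `ψm`, hence the reversed order in `b4`.
  have b2 : eLpNorm (fun z => ‖ψp z‖ₑ * ‖ζp z‖ₑ) (3 / 2) volume ≤ N * (S * T) :=
    (hN ψp ζp hpm hpm').trans (by gcongr)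
  have b3 : eLpNorm (fun z => ‖ψm z‖ₑ * ‖ζp z‖ₑ) (3 / 2) volume ≤ N * (S * T) :=
    (hN ψm ζp hmm hpm').trans (by gcongr)
  have b4 : eLpNorm (fun z => ‖ζm z‖ₑ * ‖ψm z‖ₑ) (3 / 2) volume ≤ N' * (S * T) :=
    (hN' ζm ψm hmm' hmm).trans (by rw [mul_comm S T]; gcongr)
  set f : Fin 4 → SpaceTime → ℝ≥0∞ := ![fun z => ‖ψp z‖ₑ * ‖ζm z‖ₑ, fun z => ‖ψp z‖ₑ * ‖ζp z‖ₑ,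
    fun z => ‖ψm z‖ₑ * ‖ζp z‖ₑ, fun z => ‖ζm z‖ₑ * ‖ψm z‖ₑ] with hf
  have hfm : ∀ i, AEStronglyMeasurable (f i) (volume : Measure SpaceTime) := by
    have m1 := hpm.enorm
    have m2 := hmm.enorm
    have m3 := hpm'.enorm
    have m4 := hmm'.enorm
    intro i
    fin_cases i
    · exact (m1.mul m4).aestronglyMeasurable
    · exact (m1.mul m3).aestronglyMeasurable
    · exact (m2.mul m3).aestronglyMeasurable
    · exact (m4.mul m2).aestronglyMeasurable
  calc _ ≤ eLpNorm (∑ i, f i) (3 / 2) volume := by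
        refine eLpNorm_mono_enorm_ae ?_
        filter_upwards [hψe, hζe] with z hz hz'
        rw [enorm_eq_self, enorm_eq_self, hz, hz']
        calc _ ≤ (‖ψp z‖ₑ + ‖ψm z‖ₑ) * (‖ζp z‖ₑ + ‖ζm z‖ₑ) := by
              gcongr <;> exact enorm_add_le _ _
          _ = (∑ i, f i) z := by
              simp only [hf, Fin.sum_univ_four, Pi.add_apply, Matrix.cons_val]
              ring
    _ ≤ ∑ i, eLpNorm (f i) (3 / 2) volume := eLpNorm_sum_le (fun i _ => hfm i) one_le_three_halves
    _ ≤ C₀ * (S * T) + N * (S * T) + N * (S * T) + N' * (S * T) := by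
        rw [Fin.sum_univ_four]
        exact add_le_add (add_le_add (add_le_add b1 b2) b3) b4
    _ = _ := by
        push_cast
        rw [ENNReal.coe_toNNReal hC₀']
        ring

/-! ### The endpoint bounds for the null form at `p = ∞` and `p = 3/2` -/

variable {φ : SpaceTime → E} {g : SpaceTime → PiLp 2 (fun _ : Fin 3 => E)}

/-- The pair `(∞, ∞)` is admissible, with Strichartz exponent `-1`. -/
lemma eLpNorm_top_grad_le_sNorm (χ : RadialCutoffs) {δ : ℝ} (hδ₁ : δ ≤ 1 / 10)
    (k : ℤ) (φ : SpaceTime → E) (hg : AEStronglyMeasurable g volume) :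
    eLpNorm g ⊤ volume ≤ twoPow k * sNorm χ δ k φ g := by
  have hadm : Admissible δ ⊤ ⊤ := by
    refine ⟨le_top, le_top, by simp, ?_⟩
    have h2 : (2⁻¹ : ℝ≥0∞) = ENNReal.ofReal (1 / 2) := by
      rw [one_div, ENNReal.ofReal_inv_of_pos (by norm_num)]; simp
    rw [ENNReal.inv_top, add_zero, zero_add, h2]
    exact ENNReal.ofReal_le_ofReal (by linarith)
  have h1 : twoPow (strichartzExp ⊤ ⊤ * k) * mixedNorm ⊤ ⊤ g ≤ sNorm χ δ k φ g := by
    refine le_trans ?_ (le_add_self.trans <| le_self_add.trans <| le_self_add.trans <|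
      le_self_add.trans le_self_add)
    exact le_iSup_of_le ⊤ <| le_iSup_of_le ⊤ <| le_iSup_of_le hadm le_rfl
  calc eLpNorm g ⊤ volume ≤ mixedNorm ⊤ ⊤ g := eLpNorm_top_le_mixedNorm hg
    _ = twoPow k * (twoPow (strichartzExp ⊤ ⊤ * k) * mixedNorm ⊤ ⊤ g) := by
        rw [← mul_assoc, ← twoPow_add]
        simp [strichartzExp, twoPow_zero]
    _ ≤ _ := by gcongr

lemma zNormPlus_le_sNorm (χ : RadialCutoffs) (δ : ℝ) (k : ℤ) (φ : SpaceTime → E)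
    (g : SpaceTime → PiLp 2 (fun _ : Fin 3 => E)) :
    zNormPlus χ δ k (fun z => g z 0 + radialDeriv g z) ≤ sNorm χ δ k φ g :=
  le_add_self.trans le_self_add

lemma zNormMinus_le_sNorm (χ : RadialCutoffs) (δ : ℝ) (k : ℤ) (φ : SpaceTime → E)
    (g : SpaceTime → PiLp 2 (fun _ : Fin 3 => E)) :
    zNormMinus χ δ k (fun z => g z 0 - radialDeriv g z) ≤ sNorm χ δ k φ g :=
  le_add_self

lemma enorm_bilin_le (B : E →L[ℝ] F →L[ℝ] G) (x : E) (y : F) : ‖B x y‖ₑ ≤ ‖B‖ₑ * (‖x‖ₑ * ‖y‖ₑ) := by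
  rw [← mul_assoc]
  refine ((B x).le_opENorm y).trans ?_
  gcongr
  exact B.le_opENorm x

lemma enorm_nullForm_le (B : E →L[ℝ] F →L[ℝ] G) (g : SpaceTime → PiLp 2 (fun _ : Fin 3 => E))
    (g' : SpaceTime → PiLp 2 (fun _ : Fin 3 => F)) (z : SpaceTime) :
    ‖nullForm B g g' z‖ₑ ≤ 3 * ‖B‖ₑ * (‖g z‖ₑ * ‖g' z‖ₑ) := by
  have h : ∀ i, ‖B (g z i) (g' z i)‖ₑ ≤ ‖B‖ₑ * (‖g z‖ₑ * ‖g' z‖ₑ) := fun i => by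
    refine (enorm_bilin_le B _ _).trans ?_
    gcongr
    · exact enorm_le_iff_norm_le.2 (PiLp.norm_apply_le (g z) i)
    · exact enorm_le_iff_norm_le.2 (PiLp.norm_apply_le (g' z) i)
  rw [nullForm, Fin.sum_univ_two]
  calc _ ≤ ‖B (g z 0) (g' z 0)‖ₑ + (‖B (g z 1) (g' z 1)‖ₑ + ‖B (g z 2) (g' z 2)‖ₑ) := by
        refine (enorm_add_le _ _).trans ?_
        rw [enorm_neg]
        gcongr
        exact enorm_add_le _ _
    _ ≤ ‖B‖ₑ * (‖g z‖ₑ * ‖g' z‖ₑ) + (‖B‖ₑ * (‖g z‖ₑ * ‖g' z‖ₑ) + ‖B‖ₑ * (‖g z‖ₑ * ‖g' z‖ₑ)) :=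
        add_le_add (h 0) (add_le_add (h 1) (h 2))
    _ = _ := by ring

lemma eLpNorm_top_nullForm_le (B : E →L[ℝ] F →L[ℝ] G)
    {g' : SpaceTime → PiLp 2 (fun _ : Fin 3 => F)} :
    eLpNorm (nullForm B g g') ⊤ volume ≤
      3 * ‖B‖ₑ * (eLpNorm g ⊤ volume * eLpNorm g' ⊤ volume) := by
  rw [eLpNorm_top_le_iff]
  filter_upwards [eLpNorm_top_le_iff.1 (le_refl (eLpNorm g ⊤ volume)),
    eLpNorm_top_le_iff.1 (le_refl (eLpNorm g' ⊤ volume))] with z h1 h2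
  exact (enorm_nullForm_le B g g' z).trans (by gcongr)

lemma AEStronglyMeasurable.radialDeriv (hg : AEStronglyMeasurable g volume) :
    AEStronglyMeasurable (radialDeriv g) volume := by
  refine Finset.aestronglyMeasurable_fun_sum _ fun j _ => ?_
  refine AEStronglyMeasurable.smul (Measurable.aestronglyMeasurable (by fun_prop)) ?_
  exact (PiLp.continuous_apply 2 _ j.succ).comp_aestronglyMeasurable hg

lemma exists_eLpNorm_nullForm_le [CompleteSpace E] [CompleteSpace F] (B : E →L[ℝ] F →L[ℝ] G)
    (χ : RadialCutoffs) {δ : ℝ} (hδ₀ : 0 ≤ δ) (hδ₁ : δ ≤ 1 / 10) :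
    ∃ C : NNReal, ∀ (k k' : ℤ) (φ : SpaceTime → E) (g : SpaceTime → PiLp 2 (fun _ : Fin 3 => E))
      (φ' : SpaceTime → F) (g' : SpaceTime → PiLp 2 (fun _ : Fin 3 => F)),
      IsRadial φ → IsRadial φ' → IsWeakGrad φ g → IsWeakGrad φ' g' →
      sNorm χ δ k φ g ≠ 0 → sNorm χ δ k φ g ≠ ⊤ → sNorm χ δ k' φ' g' ≠ 0 →
      sNorm χ δ k' φ' g' ≠ ⊤ →
      eLpNorm (nullForm B g g') (3 / 2) volume ≤
        C * (sNorm χ δ k φ g * sNorm χ δ k' φ' g') := by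
  obtain ⟨C, hC⟩ := χ.exists_zNorm_bound (E := E) (F := F) hδ₀ hδ₁
  obtain ⟨C', hC'⟩ := χ.exists_zNorm_bound (E := F) (F := E) hδ₀ hδ₁
  refine ⟨‖B‖₊ * (4 * (C + C')), fun k k' φ g φ' g' hr hr' h h' hS₀ hS hT₀ hT => ?_⟩
  set S := sNorm χ δ k φ g with hSdef
  set T := sNorm χ δ k' φ' g' with hTdef
  -- Doubling produces the strict inequalities needed to choose decompositions; this is why the
  -- norms must be nonzero and finite, and it costs the factor `4`.
  have hlt : ∀ {x : ℝ≥0∞}, x ≠ 0 → x ≠ ⊤ → x < 2 * x := fun {x} h0 h1 => by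
    rw [two_mul]; exact ENNReal.lt_add_right h1 h0
  have hS2 : 2 * S ≠ ⊤ := ENNReal.mul_ne_top (by simp) hS
  have hT2 : 2 * T ≠ ⊤ := ENNReal.mul_ne_top (by simp) hT
  have b1 := hC k k' _ _ (2 * S) (2 * T) hS2 hT2
    ((zNormPlus_le_sNorm χ δ k φ g).trans_lt (hlt hS₀ hS))
    ((zNormMinus_le_sNorm χ δ k' φ' g').trans_lt (hlt hT₀ hT))
  have b2 := hC' k' k _ _ (2 * T) (2 * S) hT2 hS2
    ((zNormPlus_le_sNorm χ δ k' φ' g').trans_lt (hlt hT₀ hT))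
    ((zNormMinus_le_sNorm χ δ k φ g).trans_lt (hlt hS₀ hS))
  have m0 := (h.locallyIntegrable_apply 0).aestronglyMeasurable
  have m0' := (h'.locallyIntegrable_apply 0).aestronglyMeasurable
  have m1 := AEStronglyMeasurable.radialDeriv h.locallyIntegrable_grad.aestronglyMeasurable
  have m1' := AEStronglyMeasurable.radialDeriv h'.locallyIntegrable_grad.aestronglyMeasurable
  set u : SpaceTime → ℝ≥0∞ := fun z =>
    ‖g z 0 + radialDeriv g z‖ₑ * ‖g' z 0 - radialDeriv g' z‖ₑ with hu
  set v : SpaceTime → ℝ≥0∞ := fun z =>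
    ‖g' z 0 + radialDeriv g' z‖ₑ * ‖g z 0 - radialDeriv g z‖ₑ with hv
  have hum : AEStronglyMeasurable u volume :=
    ((m0.add m1).enorm.mul (m0'.sub m1').enorm).aestronglyMeasurable
  have hvm : AEStronglyMeasurable v volume :=
    ((m0'.add m1').enorm.mul (m0.sub m1).enorm).aestronglyMeasurable
  have hpt : ∀ᵐ z, ‖nullForm B g g' z‖ₑ ≤ ‖B‖₊ * ‖(u + v) z‖ₑ := by
    filter_upwards [ae_nullForm_eq B h hr h' hr'] with z hz
    rw [hz, enorm_neg, enorm_smul, enorm_eq_self, Pi.add_apply]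
    have hhalf : ‖(1 / 2 : ℝ)‖ₑ ≤ 1 := by
      rw [Real.enorm_of_nonneg (by norm_num)]
      exact ENNReal.ofReal_le_one.2 (by norm_num)
    calc _ ≤ 1 * (‖B‖ₑ * u z + ‖B‖ₑ * v z) := by
          gcongr
          refine (enorm_add_le _ _).trans (add_le_add (enorm_bilin_le B _ _) ?_)
          exact (enorm_bilin_le B _ _).trans_eq (congrArg _ (mul_comm _ _))
      _ = _ := by rw [one_mul, ← mul_add, enorm_eq_nnnorm]
  calc _ ≤ ‖B‖₊ * eLpNorm (u + v) (3 / 2) volume := by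
        refine (eLpNorm_le_nnreal_smul_eLpNorm_of_ae_le_mul' hpt _).trans ?_
        rw [ENNReal.smul_def, smul_eq_mul]
    _ ≤ ‖B‖₊ * (C * (2 * S * (2 * T)) + C' * (2 * T * (2 * S))) := by
        gcongr
        exact (eLpNorm_add_le hum hvm one_le_three_halves).trans (add_le_add b1 b2)
    _ = _ := by
        push_cast
        ring

end

end RadialNullForm

end

/-! ### The full range of `p` -/

theorem mainTheorem8
    {E₁ E₂ G : Type*}
    [NormedAddCommGroup E₁] [NormedSpace ℝ E₁] [FiniteDimensional ℝ E₁]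
    [NormedAddCommGroup E₂] [NormedSpace ℝ E₂] [FiniteDimensional ℝ E₂]
    [NormedAddCommGroup G] [NormedSpace ℝ G]
    (B : E₁ →L[ℝ] E₂ →L[ℝ] G) (χ : RadialNullForm.RadialCutoffs) (Λ : ℝ)
    (δ : ℝ) (hδ₀ : 0 ≤ δ) (hδ₁ : δ ≤ 1 / 10) :
    ∃ C : NNReal, ∀ (p : ℝ≥0∞), 3 / 2 ≤ p → ∀ (k₁ k₂ : ℤ)
      (φ₁ : SpaceTime → E₁) (g₁ : SpaceTime → PiLp 2 (fun _ : Fin 3 => E₁))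
      (φ₂ : SpaceTime → E₂) (g₂ : SpaceTime → PiLp 2 (fun _ : Fin 3 => E₂)),
      RadialNullForm.IsRadial φ₁ → RadialNullForm.IsRadial φ₂ →
      RadialNullForm.IsWeakGrad φ₁ g₁ → RadialNullForm.IsWeakGrad φ₂ g₂ →
      RadialNullForm.HasFourierSupport Λ k₁ φ₁ → RadialNullForm.HasFourierSupport Λ k₂ φ₂ →
      eLpNorm (RadialNullForm.nullForm B g₁ g₂) p volume ≤
        C * RadialNullForm.twoPow ((1 - 3 / 2 * (p⁻¹).toReal) * (k₁ + k₂)) *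
          RadialNullForm.sNorm χ δ k₁ φ₁ g₁ * RadialNullForm.sNorm χ δ k₂ φ₂ g₂ := by
  have : CompleteSpace E₁ := FiniteDimensional.complete ℝ E₁
  have : CompleteSpace E₂ := FiniteDimensional.complete ℝ E₂
  obtain ⟨C₀, hC₀⟩ := RadialNullForm.exists_eLpNorm_nullForm_le B χ hδ₀ hδ₁
  -- `C₀` serves `p = 3/2` and `3‖B‖` serves `p = ∞`. The added `1` keeps the constant nonzero, so
  -- that an infinite norm paired with a nonzero one makes the right-hand side infinite.
  refine ⟨C₀ + 3 * ‖B‖₊ + 1, fun p hp k₁ k₂ φ₁ g₁ φ₂ g₂ hr₁ hr₂ h₁ h₂ _ _ => ?_⟩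
  set C : ℝ≥0∞ := ((C₀ + 3 * ‖B‖₊ + 1 : NNReal) : ℝ≥0∞) with hC
  have hC0 : C ≠ 0 := by simp [hC]
  have hCt : C ≠ ⊤ := ENNReal.coe_ne_top
  set S := RadialNullForm.sNorm χ δ k₁ φ₁ g₁ with hSdef
  set T := RadialNullForm.sNorm χ δ k₂ φ₂ g₂ with hTdef
  set a : ℝ := 3 / 2 * (p⁻¹).toReal with ha
  have hP : RadialNullForm.twoPow ((1 - a) * (k₁ + k₂)) ≠ 0 := by
    simp only [RadialNullForm.twoPow, ne_eq, ENNReal.ofReal_eq_zero, not_le]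
    positivity
  have bS : eLpNorm g₁ ⊤ volume ≤ RadialNullForm.twoPow k₁ * S :=
    RadialNullForm.eLpNorm_top_grad_le_sNorm χ hδ₁ k₁ φ₁
      h₁.locallyIntegrable_grad.aestronglyMeasurable
  have bT : eLpNorm g₂ ⊤ volume ≤ RadialNullForm.twoPow k₂ * T :=
    RadialNullForm.eLpNorm_top_grad_le_sNorm χ hδ₁ k₂ φ₂
      h₂.locallyIntegrable_grad.aestronglyMeasurable
  have btop : eLpNorm (RadialNullForm.nullForm B g₁ g₂) ⊤ volume ≤
      3 * ‖B‖ₑ * (eLpNorm g₁ ⊤ volume * eLpNorm g₂ ⊤ volume) :=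
    RadialNullForm.eLpNorm_top_nullForm_le B
  -- With `0 · ∞ = 0`, a vanishing norm demands a vanishing null form even when the other norm is
  -- infinite. The `L^∞` bound supplies this, as it forces the gradient to vanish almost everywhere.
  have hzero : eLpNorm g₁ ⊤ volume = 0 ∨ eLpNorm g₂ ⊤ volume = 0 →
      eLpNorm (RadialNullForm.nullForm B g₁ g₂) p volume = 0 := by
    intro h
    have h0 : eLpNorm (RadialNullForm.nullForm B g₁ g₂) ⊤ volume ≤ 0 :=
      btop.trans (by rcases h with h | h <;> simp [h])
    refine le_antisymm ?_ zero_le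
    refine (eLpNorm_mono_enorm_ae (g := fun _ => (0 : G)) ?_).trans (by simp)
    filter_upwards [RadialNullForm.eLpNorm_top_le_iff.1 h0] with z hz
    simpa using hz
  rcases eq_or_ne S 0 with hS0 | hS0
  · rw [hzero (Or.inl (by simpa [hS0] using bS))]
    exact zero_le
  rcases eq_or_ne T 0 with hT0 | hT0
  · rw [hzero (Or.inr (by simpa [hT0] using bT))]
    exact zero_le
  rcases eq_or_ne S ⊤ with hS | hS
  · rw [hS, ENNReal.mul_top (mul_ne_zero hC0 hP), ENNReal.top_mul hT0]
    exact le_top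
  rcases eq_or_ne T ⊤ with hT | hT
  · rw [hT, ENNReal.mul_top (mul_ne_zero (mul_ne_zero hC0 hP) hS0)]
    exact le_top
  have hA : eLpNorm (RadialNullForm.nullForm B g₁ g₂) (3 / 2) volume ≤ C * (S * T) := by
    refine (hC₀ k₁ k₂ φ₁ g₁ φ₂ g₂ hr₁ hr₂ h₁ h₂ hS0 hS hT0 hT).trans ?_
    gcongr
    rw [hC]
    exact_mod_cast (le_add_right le_self_add)
  have hM : eLpNorm (RadialNullForm.nullForm B g₁ g₂) ⊤ volume ≤
      C * (S * T) * RadialNullForm.twoPow (k₁ + k₂) := by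
    calc _ ≤ 3 * ‖B‖ₑ * (eLpNorm g₁ ⊤ volume * eLpNorm g₂ ⊤ volume) := btop
      _ ≤ C * ((RadialNullForm.twoPow k₁ * S) * (RadialNullForm.twoPow k₂ * T)) := by
          gcongr
          rw [hC, enorm_eq_nnnorm]
          exact_mod_cast (le_add_right le_add_self)
      _ = _ := by rw [RadialNullForm.twoPow_add]; ring
  have hST : C * (S * T) ≠ ⊤ := ENNReal.mul_ne_top hCt (ENNReal.mul_ne_top hS hT)
  have hST0 : C * (S * T) ≠ 0 := mul_ne_zero hC0 (mul_ne_zero hS0 hT0)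
  have ha1 : 0 ≤ 1 - a := by
    have h1 : (p⁻¹).toReal ≤ ((3 / 2 : ℝ≥0∞)⁻¹).toReal :=
      ENNReal.toReal_mono (by simp) (ENNReal.inv_le_inv.2 hp)
    have h2 : ((3 / 2 : ℝ≥0∞)⁻¹).toReal = 2 / 3 := by simp
    linarith
  -- The endpoint bounds differ only by `2^{k₁ + k₂}`, so interpolation affects only that factor,
  -- raising it to the power `1 - a`.
  calc _ ≤ (C * (S * T)) ^ a * (C * (S * T) * RadialNullForm.twoPow (k₁ + k₂)) ^ (1 - a) :=
        RadialNullForm.eLpNorm_le_interpolate hA hM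
          (ENNReal.mul_ne_top hST (RadialNullForm.twoPow_ne_top _)) hp
    _ = C * (S * T) * RadialNullForm.twoPow ((1 - a) * (k₁ + k₂)) := by
        rw [ENNReal.mul_rpow_of_nonneg _ _ ha1, ← mul_assoc, ← ENNReal.rpow_add _ _ hST0 hST,
          add_sub_cancel, ENNReal.rpow_one, RadialNullForm.twoPow_rpow]
    _ = _ := by ring
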